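/- **Setting.** Let $\mathcal F\neq\emptyset$ be a set of functions $\mathbb R\to\mathbb R$ invariant under the translations $(\zeta_yu)(x)=u(x+y)$, $y\in\mathbb R$, and let $(\varphi_t)_{t\in\mathbb R}$ be a flow on $\mathcal F$ ($\varphi_0=\mathrm{id}$, $\varphi_{s+t}=\varphi_s\varphi_t$) commuting with all $\zeta_y$. For every window $\Lambda=[a,b]$, $a<b$, let $d_\Lambda$ be a metric on the set $\mathcal F|_\Lambda$ of restrictions of elements of $\mathcal F$ to $\Lambda$, such that $d_{\Lambda'}\le d_\Lambda$ if $\Lambda'\subset\Lambda$, $d_{\Lambda+y}(f,g)=d_\Lambda(\zeta_yf,\zeta_yg)$, and $\mathcal F$ is the projective limit of the $\mathcal F|_\Lambda$: a function all of whose restrictions to windows belong to the sets $\mathcal F|_\Lambda$ is in $\mathcal F$. Give $\mathcal F$ the projective limit topology (generated by the $d_\Lambda$-balls, for all $\Lambda$) and its Borel $\sigma$-algebra. Assume: * (A1) every $\mathcal F|_\Lambda$ is compact; * (A2) there is an integer $q$ such that for all $\varepsilon>0$, all adjacent windows $\Lambda_1=[a,b]$, $\Lambda_2=[b,c]$ and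 all balls $B_i\subset\mathcal F|_{\Lambda_i}$ of radius $<\varepsilon$, the set of $g\in\mathcal F|_{[a,c]}$ with $g|_{\Lambda_1}\in B_1$, $g|_{\Lambda_2}\in B_2$ is covered by $q$ balls of $\mathcal F|_{[a,c]}$ of radius $<\varepsilon$; * (A3) there are $\gamma>0$, $\Gamma>1$, $C>0$ such that whenever $\varepsilon>0$, $b-a>2C\varepsilon^{-1}$, $d_{[a,b]}(f,g)<\varepsilon$ and $0<t<C^{-1}(b-a)\varepsilon$, one has, with $\delta=C\varepsilon^{-1}(t+1)$, $d_{[a+\delta,b-\delta]}(\varphi_tf,\varphi_tg)<\Gamma e^{\gamma t}\varepsilon$, provided $a+\delta<b-\delta$. **Complexity function.** Let $K$ assign a number $K(s)\ge0$ to every finite word $s$ over every finite alphabet $\mathcal A=\{1,\dots,r\}$, such that (with $\log=\log_2$, and $O(\log n)$ standing for a term at most $c\,(1+\log(n+1))$): * (H1) for each alphabet, $K(u)\le K(uv)+O(\log|u|)$ with a constant independent of $u,v$, and $K(uv)\le K(u)+K(v)+h(|u|)+h(|v|)$ for some $h\ge0$ with $h(n)/n\to0$; * (H2) if $\pi=(\pi_1,\pi_2)$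 maps an alphabet with $qr_1r_2$ letters ($q\ge1$) onto a product of alphabets with $r_1$ and $r_2$ letters, each pair having exactly $q$ preimages, then for all words $s$: $K(\pi_i(s))\le K(s)+\mathrm{const}$ and $K(s)\le K(\pi_1(s))+K(\pi_2(s))+|s|\log q+O(\log|s|)$, with constants independent of $s$; * (H3) if $E\subset\mathcal A^*\times\mathbb N$ is recursively enumerable and all $L_n=\{s:(s,n)\in E\}$ are finite, then $K(s)\le\log\mathrm{card}(L_n)+O(\log n)$ for all $n$ and $s\in L_n$, with a constant depending only on $E$; * (H4) $\mathrm{card}\{s\in\mathcal A^*:K(s)<c\}\le2^c$ for every alphabet $\mathcal A$ and all $c\in\mathbb R$. **Complexity of a measure.** Fix a time step $\tau>0$ and an admissible sequence of windows $\Lambda_k=[a_k,b_k]$, that is, $a_k<b_k$, $b_k-a_k\to\infty$, $\liminf_k\frac{b_k-a_k}{\max\{a_k,0\}}>0$ and $\liminf_k\frac{b_k-a_k}{-\min\{b_k,0\}}>0$ (a quotient with denominator $0$ being $+\infty$). For a finite covering $\mathcal U=\{U_1,\dots,U_r\}$ of $\mathcal F|_\Lambda$ by balls of radius $<\varepsilon$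 let $K(f,\tau,\mathcal U,n)$ be the minimum of $K(\omega)$ over the words $\omega=\omega_0\cdots\omega_{n-1}\in\{1,\dots,r\}^n$ with $\varphi_{j\tau}(f)|_\Lambda\in U_{\omega_j}$ for $0\le j<n$. Put $$K(f,\tau,\varepsilon,\Lambda)=\inf_{\mathcal U}\limsup_{n\to\infty}\frac{K(f,\tau,\mathcal U,n)}n,\qquad K(f,\tau,\varepsilon)=\limsup_{k\to\infty}\frac{K(f,\tau,\varepsilon,\Lambda_k)}{|\Lambda_k|},$$ and, for a probability measure $\mu$ on $\mathcal F$ invariant under all $\zeta_y$ and $\varphi_t$, $$K_\mu=\frac1\tau\lim_{\varepsilon\searrow0}\int_{\mathcal F}K(f,\tau,\varepsilon)\,d\mu(f)\in[0,\infty].$$ **Topological entropy.** Let $N^\varepsilon_\Lambda(T)$ be the maximal cardinality of a subset of $\mathcal F$ such that for any two distinct elements $f,g$ there is $t\in(0,T)$ with $d_\Lambda(\varphi_tf,\varphi_tg)\ge\varepsilon$, and let $$\overline h_{top}=\lim_{\varepsilon\searrow0}\limsup_{|\Lambda|\to\infty}\frac1{|\Lambda|}\limsup_{T\to\infty}\frac{\log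 N^\varepsilon_\Lambda(T)}T,\qquad \underline h_{top}=\lim_{\varepsilon\searrow0}\liminf_{|\Lambda|\to\infty}\frac1{|\Lambda|}\liminf_{T\to\infty}\frac{\log N^\varepsilon_\Lambda(T)}T .$$ **Theorem.** For every $\tau>0$ and every admissible sequence of windows, $$\sup\{K_\mu:\mu\text{ a }(\zeta,\varphi)\text{-invariant probability measure on }\mathcal F\}=\overline h_{top}=\underline h_{top}$$ in $[0,\infty]$; the common value of $\overline h_{top}$ and $\underline h_{top}$ is the topological entropy per unit time and volume $h_{top}$. -/

import Mathlib

open Set Filter Topology MeasureTheory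
open scoped ENNReal NNReal

noncomputable section

/-- A spatially extended system: a translation invariant set `F` of real functions on the line,
with a flow commuting with space translations and, on every window `[a, b]` with `a < b`, a metric
`d a b` on the set of restrictions of elements of `F` to `[a, b]`. A metric on the restrictions is
written as a function of two elements of `F` that vanishes exactly when their restrictions agree.
The windows form a projective system (restriction to a smaller window does not increase distances)
whose projective limit is `F`. -/
structure ExtendedSystem where
  F : Set (ℝ → ℝ)
  nonempty : F.Nonempty
  shift_mem : ∀ f ∈ F, ∀ y : ℝ, (fun x => f (x + y)) ∈ F
  flow : ℝ → F → F
  flow_zero : ∀ f, flow 0 f = f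
  flow_add : ∀ s t f, flow (s + t) f = flow s (flow t f)
  flow_shift : ∀ (t y : ℝ) (f : F),
    flow t ⟨fun x => f.1 (x + y), shift_mem f.1 f.2 y⟩ =
      ⟨fun x => (flow t f).1 (x + y), shift_mem (flow t f).1 (flow t f).2 y⟩
  d : ℝ → ℝ → F → F → ℝ
  d_eq_zero : ∀ a b, a < b → ∀ f g, d a b f g = 0 ↔ EqOn f.1 g.1 (Icc a b)
  d_symm : ∀ a b, a < b → ∀ f g, d a b f g = d a b g f
  d_triangle : ∀ a b, a < b → ∀ f g k, d a b f k ≤ d a b f g + d a b g k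
  d_mono : ∀ a b a' b', a ≤ a' → a' < b' → b' ≤ b → ∀ f g, d a' b' f g ≤ d a b f g
  d_shift : ∀ a b, a < b → ∀ (y : ℝ) (f g : F),
    d (a + y) (b + y) f g =
      d a b ⟨fun x => f.1 (x + y), shift_mem f.1 f.2 y⟩
        ⟨fun x => g.1 (x + y), shift_mem g.1 g.2 y⟩
  mem_of_windows : ∀ f : ℝ → ℝ, (∀ a b, a < b → ∃ g ∈ F, EqOn f g (Icc a b)) → f ∈ F

namespace ExtendedSystem

/-- The phase space, as a type of its own so that it carries the projective limit topology and not
the one induced by pointwise convergence. -/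
def State (S : ExtendedSystem) : Type := S.F

variable (S : ExtendedSystem)

/-- Space translation `(ζ_y u)(x) = u(x + y)`. -/
def ζ (y : ℝ) (f : S.State) : S.State := ⟨fun x => f.1 (x + y), S.shift_mem f.1 f.2 y⟩

/-- Time evolution. -/
def φ (t : ℝ) (f : S.State) : S.State := S.flow t f

/-- The distance of the restrictions of `f` and `g` to `[a, b]`. -/
def wdist (a b : ℝ) (f g : S.State) : ℝ := S.d a b f g

/-- The window metric as a pseudometric on the phase space. -/
@[reducible] def windowMetric (a b : ℝ) (hab : a < b) : PseudoMetricSpace S.State where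
  dist := S.wdist a b
  dist_self f := (S.d_eq_zero a b hab f f).2 fun _ _ => rfl
  dist_comm := S.d_symm a b hab
  dist_triangle := S.d_triangle a b hab

/-- The projective limit topology: generated by all balls in all windows. -/
instance : TopologicalSpace S.State :=
  TopologicalSpace.generateFrom
    {B | ∃ (a b : ℝ) (f : S.State) (r : ℝ), a < b ∧ B = {g | S.wdist a b g f < r}}

instance : MeasurableSpace S.State := borel S.State

/-- The restriction of the phase space to any bounded window is compact. -/
def WindowsCompact : Prop :=
  ∀ (a b : ℝ) (hab : a < b),
    @CompactSpace S.State (S.windowMetric a b hab).toUniformSpace.toTopologicalSpace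

/-- There is an integer `q` such that, for adjacent windows, the functions lying in a ball of radius
`< ε` over the first window and in a ball of radius `< ε` over the second one are covered by `q`
balls of radius `< ε` over the union of the windows. -/
def BallsGlue : Prop :=
  ∃ q : ℕ, ∀ ε : ℝ, 0 < ε → ∀ a b c : ℝ, a < b → b < c →
    ∀ (f₁ f₂ : S.State) (r₁ r₂ : ℝ), 0 < r₁ → r₁ < ε → 0 < r₂ → r₂ < ε →
      ∃ (z : Fin q → S.State) (ρ : Fin q → ℝ), (∀ i, 0 < ρ i ∧ ρ i < ε) ∧
        ∀ g : S.State, S.wdist a b g f₁ < r₁ → S.wdist b c g f₂ < r₂ →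
          ∃ i, S.wdist a c g (z i) < ρ i

/-- Bound on the speed of separation: nearby functions in a window separate at most exponentially,
in the window deprived of the points at distance `< C ε⁻¹ (t + 1)` from its boundary. The last
hypothesis says that what is left of the window is a nondegenerate interval. -/
def SeparationBound : Prop :=
  ∃ γ Γ C : ℝ, 0 < γ ∧ 1 < Γ ∧ 0 < C ∧
    ∀ a b ε : ℝ, 0 < ε → 2 * C * ε⁻¹ < b - a →
      ∀ f g : S.State, S.wdist a b f g < ε →
        ∀ t : ℝ, 0 < t → t < C⁻¹ * (b - a) * ε →
          a + C * ε⁻¹ * (t + 1) < b - C * ε⁻¹ * (t + 1) →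
            S.wdist (a + C * ε⁻¹ * (t + 1)) (b - C * ε⁻¹ * (t + 1)) (S.φ t f) (S.φ t g)
              < Γ * Real.exp (γ * t) * ε

/-! ### Topological entropy per unit time and volume -/

/-- `f` and `g` have `([a, b], T, ε)`-indistinguishable orbits. -/
def Indistinguishable (a b T ε : ℝ) (f g : S.State) : Prop :=
  ∀ t ∈ Ioo 0 T, S.wdist a b (S.φ t f) (S.φ t g) < ε

/-- The maximal cardinality of a set of pairwise `([a, b], T, ε)`-distinguishable orbits. -/
def maxOrbits (a b T ε : ℝ) : ℕ∞ :=
  ⨆ (A : Set S.State) (_ : A.Pairwise fun f g => ¬ S.Indistinguishable a b T ε f g), A.encard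

/-- Base two logarithm of a (possibly infinite) cardinality. -/
def _root_.log₂card (N : ℕ∞) : ℝ≥0∞ :=
  if N = ⊤ then ⊤ else ENNReal.ofReal (Real.logb 2 N.toNat)

/-- `|Λ| → ∞` for windows `Λ = [a, b]`, encoded as pairs `(a, b)`. -/
def _root_.windowsToInfinity : Filter (ℝ × ℝ) := comap (fun Λ => Λ.2 - Λ.1) atTop

/-- Topological entropy per unit time and volume, with upper limits in time and space. The quantity
decreases with `ε`, so its limit as `ε → 0` is the supremum. -/
def upperTopEntropy : ℝ≥0∞ :=
  ⨆ (ε : ℝ) (_ : 0 < ε),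
    limsup (fun Λ : ℝ × ℝ =>
      limsup (fun T : ℝ => log₂card (S.maxOrbits Λ.1 Λ.2 T ε) / ENNReal.ofReal T) atTop
        / ENNReal.ofReal (Λ.2 - Λ.1)) windowsToInfinity

/-- Topological entropy per unit time and volume, with lower limits in time and space. -/
def lowerTopEntropy : ℝ≥0∞ :=
  ⨆ (ε : ℝ) (_ : 0 < ε),
    liminf (fun Λ : ℝ × ℝ =>
      liminf (fun T : ℝ => log₂card (S.maxOrbits Λ.1 Λ.2 T ε) / ENNReal.ofReal T) atTop
        / ENNReal.ofReal (Λ.2 - Λ.1)) windowsToInfinity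

/-- Invariance of a measure under all space translations and under the flow. -/
structure IsInvariant (μ : Measure S.State) : Prop where
  shift : ∀ y, MeasurePreserving (S.ζ y) μ μ
  flow : ∀ t, MeasurePreserving (S.φ t) μ μ

end ExtendedSystem

/-! ### Complexity functions -/

/-- A function assigning a nonnegative number to every finite word over every finite alphabet; the
alphabet with `r` letters is `Fin r`. -/
abbrev ComplexityFunction : Type := (r : ℕ) → List (Fin r) → ℝ≥0

namespace ComplexityFunction

variable (K : ComplexityFunction)

/-- A logarithmic error term `O(log n)`. -/
def logError (c : ℝ) (n : ℕ) : ℝ := c * (1 + Real.logb 2 (n + 1))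

/-- Behaviour on initial subwords, and subadditivity under concatenation. -/
structure Concat : Prop where
  prefix_le : ∀ r : ℕ, ∃ c : ℝ, ∀ u v : List (Fin r),
    (K r u : ℝ) ≤ K r (u ++ v) + logError c u.length
  append_le : ∀ r : ℕ, ∃ h : ℕ → ℝ≥0, Tendsto (fun n : ℕ => (h n : ℝ) / n) atTop (𝓝 0) ∧
    ∀ u v : List (Fin r), K r (u ++ v) ≤ K r u + K r v + h u.length + h v.length

/-- Behaviour under projections: `π` maps an alphabet with `q r₁ r₂` letters onto the product of
two alphabets with `r₁` and `r₂` letters, every pair being the image of `q` letters. -/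
def Projection : Prop :=
  ∀ (r₁ r₂ q : ℕ) (π : Fin (q * r₁ * r₂) → Fin r₁ × Fin r₂), 1 ≤ q →
    (∀ p, {a | π a = p}.ncard = q) → ∃ c : ℝ, ∀ s : List (Fin (q * r₁ * r₂)),
      (K r₁ (s.map fun a => (π a).1) : ℝ) ≤ K _ s + c ∧
      (K r₂ (s.map fun a => (π a).2) : ℝ) ≤ K _ s + c ∧
      (K _ s : ℝ) ≤ K r₁ (s.map fun a => (π a).1) + K r₂ (s.map fun a => (π a).2)
        + s.length * Real.logb 2 q + logError c s.length

/-- Shannon-type bound over a recursively enumerable family of finite sets of words. -/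
def Shannon : Prop :=
  ∀ (r : ℕ) (E : Set (List (Fin r) × ℕ)), REPred (fun p => p ∈ E) →
    (∀ n : ℕ, {s | (s, n) ∈ E}.Finite) →
      ∃ c : ℝ, ∀ (n : ℕ) (s : List (Fin r)), (s, n) ∈ E →
        (K r s : ℝ) ≤ Real.logb 2 ({s' | (s', n) ∈ E}.ncard) + logError c n

/-- Counting bound. -/
def Counting : Prop :=
  ∀ (r : ℕ) (c : ℝ), {s : List (Fin r) | (K r s : ℝ) < c}.Finite ∧
    ({s : List (Fin r) | (K r s : ℝ) < c}.ncard : ℝ) ≤ (2 : ℝ) ^ c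

end ComplexityFunction

/-! ### Complexity per unit time and volume -/

namespace ExtendedSystem

variable (S : ExtendedSystem)

/-- A finite covering of the restrictions to `[a, b]` by balls of radius `< ε`. -/
structure Covering (a b ε : ℝ) where
  card : ℕ
  center : Fin card → S.State
  radius : Fin card → ℝ
  radius_pos : ∀ i, 0 < radius i
  radius_lt : ∀ i, radius i < ε
  covers : ∀ f, ∃ i, S.wdist a b f (center i) < radius i

variable {S}

/-- `ω` is a symbolic coding of the first `n` points of the orbit of `f` with time step `τ`. -/
def Covering.Codes {a b ε : ℝ} (U : S.Covering a b ε) (τ : ℝ) (f : S.State) (n : ℕ)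
    (ω : Fin n → Fin U.card) : Prop :=
  ∀ j : Fin n, S.wdist a b (S.φ (j * τ) f) (U.center (ω j)) < U.radius (ω j)

/-- Minimal complexity of a coding of the first `n` points of the orbit of `f`. -/
def Covering.orbitComplexity {a b ε : ℝ} (U : S.Covering a b ε) (K : ComplexityFunction) (τ : ℝ)
    (f : S.State) (n : ℕ) : ℝ≥0∞ :=
  ⨅ (ω : Fin n → Fin U.card) (_ : U.Codes τ f n ω), (K U.card (List.ofFn ω) : ℝ≥0∞)

/-- Complexity of the orbit of `f` per time step, for a given covering (the upper limit, which is
the limit wherever the limit exists). -/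
def Covering.rate {a b ε : ℝ} (U : S.Covering a b ε) (K : ComplexityFunction) (τ : ℝ)
    (f : S.State) : ℝ≥0∞ :=
  limsup (fun n : ℕ => U.orbitComplexity K τ f n / n) atTop

variable (S)

/-- Complexity of the orbit of `f` per time step in the window `[a, b]` at precision `ε`. -/
def windowComplexity (K : ComplexityFunction) (τ ε a b : ℝ) (f : S.State) : ℝ≥0∞ :=
  ⨅ U : S.Covering a b ε, U.rate K τ f

/-- Admissible sequences of windows `[a k, b k]`: the lengths tend to infinity and the windows do
not move too fast to the right or to the left. Note that `ENNReal.ofReal x` is `max x 0` and that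
the quotients are infinite where the denominator vanishes. -/
structure _root_.AdmissibleWindows (a b : ℕ → ℝ) : Prop where
  lt : ∀ k, a k < b k
  length : Tendsto (fun k => b k - a k) atTop atTop
  right : 0 < liminf (fun k => ENNReal.ofReal (b k - a k) / ENNReal.ofReal (a k)) atTop
  left : 0 < liminf (fun k => ENNReal.ofReal (b k - a k) / ENNReal.ofReal (-b k)) atTop

/-- Complexity per time step and unit volume of the orbit of `f` along the windows
`[a k, b k]`. -/
def pointComplexity (K : ComplexityFunction) (τ ε : ℝ) (a b : ℕ → ℝ) (f : S.State) : ℝ≥0∞ :=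
  limsup (fun k => S.windowComplexity K τ ε (a k) (b k) f / ENNReal.ofReal (b k - a k)) atTop

/-- Complexity `K_μ` per unit time and volume of an invariant measure, computed with time step `τ`
along the windows `[a k, b k]`: the mean of the complexity of the orbits, in the limit `ε → 0`
(a supremum, as coarser precision gives smaller complexity), divided by `τ`. -/
def measureComplexity (K : ComplexityFunction) (τ : ℝ) (a b : ℕ → ℝ) (μ : Measure S.State) :
    ℝ≥0∞ :=
  (⨆ (ε : ℝ) (_ : 0 < ε), ∫⁻ f, S.pointComplexity K τ ε a b f ∂μ) / ENNReal.ofReal τ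

end ExtendedSystem

end

/-!
Upper bound. A maximal separated set of orbits over a long window and a long time gives few strings
of balls that together code every orbit there. Gluing these strings in space by (A2), and
concatenating them in time, codes all orbits over all longer windows and times, and (H3) bounds the
complexity of the resulting words by the logarithm of their number. Hence no orbit is more complex
than the lower entropy.

Lower bound. If strings of balls are coded with costs whose Kraft sum is moderate, then by Jensen's
inequality the cost averaged over a large separated set of orbits is at least the logarithm of its
size, up to the overhead of gluing. Averaging also over space-time lattice translates, an invariant
mean and the Riesz representation theorem produce a single invariant measure under which every
continuous coding cost is large; the flow is not assumed continuous in time, so the mean is taken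
over `ℝ × ℝ` as a discrete group. The complexity `K` is turned into a continuous cost by penalizing
words that miss the orbit, (H4) bounds the Kraft sum, and Fatou's lemma passes to the rates.
-/

noncomputable section

open scoped BigOperators

namespace ExtendedSystem

variable {S : ExtendedSystem}

/-! ### Window distances -/

theorem wdist_self {a b : ℝ} (hab : a < b) (f : S.State) : S.wdist a b f f = 0 :=
  (S.windowMetric a b hab).dist_self f

theorem wdist_comm {a b : ℝ} (hab : a < b) (f g : S.State) : S.wdist a b f g = S.wdist a b g f :=
  S.d_symm a b hab f g

theorem wdist_triangle {a b : ℝ} (hab : a < b) (f g k : S.State) :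
    S.wdist a b f k ≤ S.wdist a b f g + S.wdist a b g k :=
  S.d_triangle a b hab f g k

theorem wdist_nonneg {a b : ℝ} (hab : a < b) (f g : S.State) : 0 ≤ S.wdist a b f g :=
  @dist_nonneg _ (S.windowMetric a b hab) f g

theorem wdist_mono {a b a' b' : ℝ} (ha : a ≤ a') (h : a' < b') (hb : b' ≤ b) (f g : S.State) :
    S.wdist a' b' f g ≤ S.wdist a b f g :=
  S.d_mono a b a' b' ha h hb f g

theorem wdist_eq_zero {a b : ℝ} (hab : a < b) {f g : S.State} :
    S.wdist a b f g = 0 ↔ EqOn f.1 g.1 (Icc a b) :=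
  S.d_eq_zero a b hab f g

theorem wdist_shift {a b : ℝ} (hab : a < b) (y : ℝ) (f g : S.State) :
    S.wdist a b (S.ζ y f) (S.ζ y g) = S.wdist (a + y) (b + y) f g :=
  (S.d_shift a b hab y f g).symm

theorem ζ_zero (f : S.State) : S.ζ 0 f = f :=
  Subtype.ext (funext fun x => congrArg f.1 (add_zero x))

theorem ζ_add (y z : ℝ) (f : S.State) : S.ζ (y + z) f = S.ζ y (S.ζ z f) :=
  Subtype.ext (funext fun x => congrArg f.1 (add_assoc x y z).symm)

theorem φ_zero (f : S.State) : S.φ 0 f = f := S.flow_zero f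

theorem φ_add (s t : ℝ) (f : S.State) : S.φ (s + t) f = S.φ s (S.φ t f) := S.flow_add s t f

theorem φ_ζ (t y : ℝ) (f : S.State) : S.φ t (S.ζ y f) = S.ζ y (S.φ t f) := S.flow_shift t y f

theorem wdist_φ_ζ {a b : ℝ} (hab : a < b) (s y t : ℝ) (f z : S.State) :
    S.wdist a b (S.φ s (S.ζ y (S.φ t f))) z =
      S.wdist (a + y) (b + y) (S.φ (s + t) f) (S.ζ (-y) z) := by
  rw [φ_ζ, ← φ_add, ← wdist_shift hab, ← ζ_add, add_neg_cancel, ζ_zero]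

/-! ### The projective limit topology -/

theorem isOpen_wdist_lt {a b : ℝ} (hab : a < b) (f : S.State) (r : ℝ) :
    IsOpen {g : S.State | S.wdist a b g f < r} :=
  TopologicalSpace.isOpen_generateFrom_of_mem ⟨a, b, f, r, hab, rfl⟩

theorem eventually_wdist_lt {a b : ℝ} (hab : a < b) (f : S.State) {ε : ℝ} (hε : 0 < ε) :
    ∀ᶠ g in 𝓝 f, S.wdist a b g f < ε :=
  (isOpen_wdist_lt hab f ε).mem_nhds (show S.wdist a b f f < ε by rwa [wdist_self hab])

theorem neg_succ_lt_succ (n : ℕ) : -((n : ℝ) + 1) < n + 1 := by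
  linarith [n.cast_nonneg (α := ℝ)]

theorem exists_nat_window (a b : ℝ) : ∃ n : ℕ, -((n : ℝ) + 1) ≤ a ∧ b ≤ n + 1 := by
  obtain ⟨n, hn⟩ := exists_nat_ge (max (-a) b)
  exact ⟨n, by linarith [le_max_left (-a) b], by linarith [le_max_right (-a) b]⟩

theorem tendsto_nhds_iff {ι : Type*} {l : Filter ι} {u : ι → S.State} {f : S.State} :
    Tendsto u l (𝓝 f) ↔
      ∀ n : ℕ, ∀ ε > 0, ∀ᶠ x in l, S.wdist (-((n : ℝ) + 1)) (n + 1) (u x) f < ε := by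
  refine ⟨fun h n ε hε => h.eventually (eventually_wdist_lt (neg_succ_lt_succ n) f hε),
    fun h => TopologicalSpace.tendsto_nhds_generateFrom_iff.2 ?_⟩
  rintro _ ⟨a, b, z, r, hab, rfl⟩ hfz
  obtain ⟨n, ha, hb⟩ := exists_nat_window a b
  filter_upwards [h n (r - S.wdist a b f z) (sub_pos.2 hfz)] with x hx
  have h₁ := wdist_triangle hab (u x) f z
  have h₂ := wdist_mono ha hab hb (u x) f
  change S.wdist a b (u x) z < r
  linarith

theorem continuous_wdist {a b : ℝ} (hab : a < b) (z : S.State) :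
    Continuous fun f : S.State => S.wdist a b f z := by
  refine continuous_iff_continuousAt.2 fun f => Metric.tendsto_nhds.2 fun ε hε => ?_
  filter_upwards [eventually_wdist_lt hab f hε] with g hg
  have h₁ := wdist_triangle hab g f z
  have h₂ := wdist_triangle hab f g z
  rw [wdist_comm hab f g] at h₂
  rw [Real.dist_eq, abs_lt]
  constructor <;> linarith

theorem continuous_ζ (y : ℝ) : Continuous (S.ζ y) := by
  refine continuous_iff_continuousAt.2 fun f => tendsto_nhds_iff.2 fun n ε hε => ?_
  simp only [wdist_shift (neg_succ_lt_succ n)]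
  exact eventually_wdist_lt (by linarith [neg_succ_lt_succ n]) f hε

theorem eqOn_of_eventually_wdist_lt {a b : ℝ} (hab : a < b) {l : Filter S.State} [l.NeBot]
    {f g : S.State} (hf : ∀ ε > 0, ∀ᶠ k in l, S.wdist a b k f < ε)
    (hg : ∀ ε > 0, ∀ᶠ k in l, S.wdist a b k g < ε) : EqOn f.1 g.1 (Icc a b) := by
  refine (wdist_eq_zero hab).1 (le_antisymm (le_of_forall_pos_le_add fun ε hε => ?_)
    (wdist_nonneg hab f g))
  obtain ⟨k, hkf, hkg⟩ := ((hf (ε / 2) (half_pos hε)).and (hg (ε / 2) (half_pos hε))).exists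
  have := wdist_triangle hab f k g
  rw [wdist_comm hab f k] at this
  linarith

instance : T2Space S.State := by
  refine t2_iff_nhds.2 fun {f g} hfg => Subtype.ext (funext fun x => ?_)
  have hx : x - 1 < x + 1 := by linarith
  exact eqOn_of_eventually_wdist_lt (l := 𝓝 f ⊓ 𝓝 g) hx
    (fun ε hε => (eventually_wdist_lt hx f hε).filter_mono inf_le_left)
    (fun ε hε => (eventually_wdist_lt hx g hε).filter_mono inf_le_right)
    ⟨by linarith, by linarith⟩

theorem topology_eq_iInf :
    (inferInstance : TopologicalSpace S.State) =
      ⨅ n : ℕ, (S.windowMetric _ _ (neg_succ_lt_succ n)).toUniformSpace.toTopologicalSpace := by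
  refine TopologicalSpace.ext_nhds fun f => eq_of_forall_le_iff fun l => ?_
  rw [nhds_iInf, le_iInf_iff]
  refine tendsto_nhds_iff.trans (forall_congr' fun n => ?_)
  exact (@Metric.tendsto_nhds _ _ (S.windowMetric _ _ (neg_succ_lt_succ n)) l id f).symm

instance : TopologicalSpace.PseudoMetrizableSpace S.State := by
  have key : @TopologicalSpace.PseudoMetrizableSpace S.State
      (⨅ n : ℕ, (S.windowMetric _ _ (neg_succ_lt_succ n)).toUniformSpace).toTopologicalSpace := by
    let _ : UniformSpace S.State :=
      ⨅ n : ℕ, (S.windowMetric _ _ (neg_succ_lt_succ n)).toUniformSpace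
    have : IsCountablyGenerated (uniformity S.State) := by
      rw [iInf_uniformity]
      have (n : ℕ) : IsCountablyGenerated (@uniformity S.State
          (S.windowMetric _ _ (neg_succ_lt_succ n)).toUniformSpace) :=
        @EMetric.instIsCountablyGeneratedUniformity S.State
          (S.windowMetric _ _ (neg_succ_lt_succ n)).toPseudoEMetricSpace
      exact Filter.iInf.isCountablyGenerated _
    exact UniformSpace.pseudoMetrizableSpace
  rwa [UniformSpace.toTopologicalSpace_iInf, ← topology_eq_iInf] at key

instance : BorelSpace S.State := ⟨rfl⟩

/-! ### Compactness of the phase space and continuity of the flow -/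

theorem WindowsCompact.exists_eventually_wdist_lt (hA1 : S.WindowsCompact)
    (u : Ultrafilter S.State) {a b : ℝ} (hab : a < b) :
    ∃ f : S.State, ∀ ε > 0, ∀ᶠ g in (u : Filter S.State), S.wdist a b g f < ε := by
  obtain ⟨f, -, hf⟩ := @IsCompact.ultrafilter_le_nhds _
    (S.windowMetric a b hab).toUniformSpace.toTopologicalSpace _ (hA1 a b hab).isCompact_univ u
    (by simp)
  exact ⟨f, fun ε hε => hf (@Metric.ball_mem_nhds _ (S.windowMetric a b hab) f ε hε)⟩

theorem exists_state_of_compatible (F : ℕ → S.State)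
    (hF : ∀ n m : ℕ, n ≤ m → EqOn (F n).1 (F m).1 (Icc (-((n : ℝ) + 1)) (n + 1))) :
    ∃ f : S.State, ∀ n : ℕ, EqOn f.1 (F n).1 (Icc (-((n : ℝ) + 1)) (n + 1)) := by
  let f : ℝ → ℝ := fun x => (F ⌈|x|⌉₊).1 x
  have hf (n : ℕ) : EqOn f (F n).1 (Icc (-((n : ℝ) + 1)) (n + 1)) := by
    intro x hx
    have hx' := Nat.le_ceil |x|
    rcases le_total n ⌈|x|⌉₊ with h | h
    · exact (hF n _ h hx).symm
    · exact hF _ n h ⟨by linarith [neg_abs_le x], by linarith [le_abs_self x]⟩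
  refine ⟨⟨f, S.mem_of_windows f fun a b _ => ?_⟩, hf⟩
  obtain ⟨n, ha, hb⟩ := exists_nat_window a b
  exact ⟨(F n).1, (F n).2, (hf n).mono (Icc_subset_Icc ha hb)⟩

theorem WindowsCompact.compactSpace (hA1 : S.WindowsCompact) : CompactSpace S.State := by
  refine ⟨isCompact_iff_ultrafilter_le_nhds.2 fun u _ => ?_⟩
  choose F hF using fun n : ℕ => hA1.exists_eventually_wdist_lt u (neg_succ_lt_succ n)
  obtain ⟨f, hf⟩ := exists_state_of_compatible F fun n m hnm => by
    have hnm' : (n : ℝ) ≤ m := mod_cast hnm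
    exact eqOn_of_eventually_wdist_lt (neg_succ_lt_succ n) (hF n) fun ε hε =>
      (hF m ε hε).mono fun g =>
        (wdist_mono (by linarith) (neg_succ_lt_succ n) (by linarith) g (F m)).trans_lt
  refine ⟨f, mem_univ f, tendsto_nhds_iff.2 fun n ε hε => (hF n ε hε).mono fun g hg => ?_⟩
  have h₁ := wdist_triangle (neg_succ_lt_succ n) g (F n) f
  have h₂ := (wdist_eq_zero (neg_succ_lt_succ n)).2 (hf n).symm
  change S.wdist _ _ g f < ε
  linarith

theorem SeparationBound.exists_wdist_φ_lt (hA3 : S.SeparationBound) :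
    ∃ γ Γ C : ℝ, 0 < γ ∧ 1 < Γ ∧ 0 < C ∧ ∀ η > 0, ∀ A B, A < B → ∀ t > 0, ∀ f g : S.State,
      S.wdist (A - C * η⁻¹ * (t + 1)) (B + C * η⁻¹ * (t + 1)) f g < η →
        S.wdist A B (S.φ t f) (S.φ t g) < Γ * Real.exp (γ * t) * η := by
  obtain ⟨γ, Γ, C, hγ, hΓ, hC, H⟩ := hA3
  refine ⟨γ, Γ, C, hγ, hΓ, hC, fun η hη A B hAB t ht f g hfg => ?_⟩
  set δ := C * η⁻¹ * (t + 1) with hδ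
  have : 0 < B - A := sub_pos.2 hAB
  have hlength : 2 * C * η⁻¹ < B + δ - (A - δ) := by
    have : 0 < C * η⁻¹ * t := by positivity
    linarith
  have htime : t < C⁻¹ * (B + δ - (A - δ)) * η :=
    calc t < 2 * (t + 1) + C⁻¹ * (B - A) * η := by
          have : 0 < C⁻¹ * (B - A) * η := by positivity
          linarith
      _ = C⁻¹ * (B + δ - (A - δ)) * η := by rw [hδ]; field_simp; ring
  simpa only [← hδ, sub_add_cancel, add_sub_cancel_right] using
    H (A - δ) (B + δ) η hη hlength f g hfg t ht htime (by rw [← hδ]; linarith)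

variable (S) in
/-- Uniform continuity of the flow up to time `τ`: states that are `η`-close over a window stay
`ε`-close over that window deprived of its points at distance less than `δ` from its boundary. -/
def StaysClose (τ η δ ε : ℝ) : Prop :=
  ∀ A B : ℝ, A < B → ∀ t, 0 ≤ t → t ≤ τ → ∀ f g : S.State,
    S.wdist (A - δ) (B + δ) f g < η → S.wdist A B (S.φ t f) (S.φ t g) < ε

theorem SeparationBound.exists_staysClose (hA3 : S.SeparationBound) (τ : ℝ) {ε : ℝ}
    (hε : 0 < ε) : ∃ η δ : ℝ, 0 < η ∧ 0 ≤ δ ∧ S.StaysClose τ η δ ε := by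
  obtain ⟨γ, Γ, C, hγ, hΓ, hC, H⟩ := hA3.exists_wdist_φ_lt
  set D := Γ * Real.exp (γ * |τ|) with hD
  have hD1 : 1 ≤ D := one_le_mul_of_one_le_of_one_le hΓ.le (Real.one_le_exp (by positivity))
  set η := ε / D
  have hη0 : 0 < η := by positivity
  refine ⟨η, C * η⁻¹ * (|τ| + 1), hη0, by positivity, fun A B hAB t ht0 htτ f g hfg => ?_⟩
  rcases ht0.eq_or_lt with rfl | ht
  · have : 0 ≤ C * η⁻¹ * (|τ| + 1) := by positivity
    rw [φ_zero, φ_zero]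
    exact ((wdist_mono (by linarith) hAB (by linarith) f g).trans_lt hfg).trans_le
      (div_le_self hε.le hD1)
  have htτ' : t ≤ |τ| := htτ.trans (le_abs_self τ)
  have hδ : C * η⁻¹ * (t + 1) ≤ C * η⁻¹ * (|τ| + 1) := by gcongr
  have hδ0 : 0 < C * η⁻¹ * (t + 1) := by positivity
  calc S.wdist A B (S.φ t f) (S.φ t g) < Γ * Real.exp (γ * t) * η :=
        H η hη0 A B hAB t ht f g
          ((wdist_mono (by linarith) (by linarith) (by linarith) f g).trans_lt hfg)
    _ ≤ D * η := by rw [hD]; gcongr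
    _ = ε := mul_div_cancel₀ ε (by positivity)

theorem SeparationBound.continuous_φ_of_nonneg (hA3 : S.SeparationBound) {t : ℝ} (ht : 0 ≤ t) :
    Continuous (S.φ t) := by
  refine continuous_iff_continuousAt.2 fun f => tendsto_nhds_iff.2 fun n ε hε => ?_
  obtain ⟨η, δ, hη, hδ, hclose⟩ := hA3.exists_staysClose t hε
  exact (eventually_wdist_lt (by linarith [neg_succ_lt_succ n]) f hη).mono fun g hg =>
    hclose _ _ (neg_succ_lt_succ n) t ht le_rfl g f hg

theorem SeparationBound.continuous_φ (hA3 : S.SeparationBound) (hA1 : S.WindowsCompact) (t : ℝ) :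
    Continuous (S.φ t) := by
  have := hA1.compactSpace
  rcases le_total 0 t with ht | ht
  · exact hA3.continuous_φ_of_nonneg ht
  -- The inverse of a continuous bijection of a compact Hausdorff space is continuous.
  let e : S.State ≃ S.State :=
    { toFun := S.φ (-t)
      invFun := S.φ t
      left_inv := fun f => by rw [← φ_add, add_neg_cancel, φ_zero]
      right_inv := fun f => by rw [← φ_add, neg_add_cancel, φ_zero] }
  have he : Continuous e := hA3.continuous_φ_of_nonneg (neg_nonneg.2 ht)
  exact (Continuous.homeoOfEquivCompactToT2 he).symm.continuous

/-! ### Strings of balls -/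

variable (S) in
/-- A ball of radius `< ε`. The window over which it is considered is not part of the data, so that
one centre and radius can be used over several windows. -/
structure Ball (ε : ℝ) where
  center : S.State
  radius : ℝ
  radius_pos : 0 < radius
  radius_lt : radius < ε

/-- Membership in a ball over the window `[a, b]`. -/
def Ball.Mem {ε : ℝ} (a b : ℝ) (B : S.Ball ε) (f : S.State) : Prop :=
  S.wdist a b f B.center < B.radius

/-- The ball `B` with its centre translated by `y`. -/
def Ball.shift {ε : ℝ} (y : ℝ) (B : S.Ball ε) : S.Ball ε :=
  { B with center := S.ζ y B.center }

/-- The orbit of `f` over the window `[a, b]` visits the balls of the string `s` at the times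
`0, τ, …, (n - 1) τ`. -/
def Follows {ε : ℝ} {n : ℕ} (τ a b : ℝ) (s : Fin n → S.Ball ε) (f : S.State) : Prop :=
  ∀ j, (s j).Mem a b (S.φ (j * τ) f)

section

variable {ε τ a b : ℝ} {n : ℕ}

theorem Ball.precision_pos (B : S.Ball ε) : 0 < ε := B.radius_pos.trans B.radius_lt

theorem Ball.Mem.mono {a' b' : ℝ} {B : S.Ball ε} {f : S.State} (h : B.Mem a b f) (ha : a ≤ a')
    (hab : a' < b') (hb : b' ≤ b) : B.Mem a' b' f :=
  (wdist_mono ha hab hb _ _).trans_lt h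

theorem Follows.mono {a' b' : ℝ} {s : Fin n → S.Ball ε} {f : S.State} (h : Follows τ a b s f)
    (ha : a ≤ a') (hab : a' < b') (hb : b' ≤ b) : Follows τ a' b' s f :=
  fun j => (h j).mono ha hab hb

theorem mem_φ_ζ_iff (hab : a < b) (s y t : ℝ) (f : S.State) (B : S.Ball ε) :
    B.Mem a b (S.φ s (S.ζ y (S.φ t f))) ↔
      (B.shift (-y)).Mem (a + y) (b + y) (S.φ (s + t) f) := by
  rw [Ball.Mem, wdist_φ_ζ hab]
  rfl

end

variable (S) in
/-- Two balls over adjacent windows are covered by `q` balls over the union of the windows. This is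
`BallsGlue` for a given integer `q`. -/
def GluesWith (q : ℕ) : Prop :=
  ∀ (ε a b c : ℝ), a < b → b < c → ∀ B₁ B₂ : S.Ball ε, ∃ D : Fin q → S.Ball ε,
    ∀ f, B₁.Mem a b f → B₂.Mem b c f → ∃ i, (D i).Mem a c f

theorem BallsGlue.exists_gluesWith (hA2 : S.BallsGlue) : ∃ q, S.GluesWith q := by
  obtain ⟨q, hq⟩ := hA2
  refine ⟨q, fun ε a b c hab hbc B₁ B₂ => ?_⟩
  obtain ⟨z, ρ, hρ, hz⟩ := hq ε B₁.precision_pos a b c hab hbc B₁.center B₂.center B₁.radius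
    B₂.radius B₁.radius_pos B₁.radius_lt B₂.radius_pos B₂.radius_lt
  exact ⟨fun i => ⟨z i, ρ i, (hρ i).1, (hρ i).2⟩, hz⟩

theorem GluesWith.pos {q : ℕ} (hq : S.GluesWith q) : 0 < q := by
  obtain ⟨f⟩ : Nonempty S.State := S.nonempty.to_subtype
  let B : S.Ball 2 := ⟨f, 1, one_pos, one_lt_two⟩
  have hB {a b : ℝ} (hab : a < b) : B.Mem a b f := (wdist_self hab f).trans_lt one_pos
  obtain ⟨D, hD⟩ := hq 2 0 1 2 one_pos one_lt_two B B
  obtain ⟨i, -⟩ := hD f (hB one_pos) (hB one_lt_two)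
  exact i.pos

theorem GluesWith.consecutive {q : ℕ} (hq : S.GluesWith q) {ε L : ℝ} (hL : 0 < L) (x : ℝ) {P : ℕ}
    (hP : 0 < P) (B : Fin P → S.Ball ε) :
    ∃ D : Fin (q ^ P) → S.Ball ε, ∀ f,
      (∀ p : Fin P, (B p).Mem (x + p * L) (x + (p + 1) * L) f) →
        ∃ i, (D i).Mem x (x + P * L) f := by
  induction P, hP using Nat.le_induction with
  | base =>
    refine ⟨fun _ => B 0, fun f hf => ⟨⟨0, by simpa using hq.pos⟩, ?_⟩⟩
    simpa using hf 0
  | succ P hP ih =>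
    obtain ⟨D, hD⟩ := ih fun p => B p.castSucc
    have hP0 : 0 < P * L := mul_pos (mod_cast hP) hL
    choose D' hD' using fun i => hq ε x (x + P * L) (x + (P + 1) * L) (by linarith) (by linarith)
      (D i) (B (Fin.last P))
    let e : Fin (q ^ (P + 1)) ≃ Fin (q ^ P) × Fin q :=
      (finCongr (pow_succ q P)).trans finProdFinEquiv.symm
    refine ⟨fun i => D' (e i).1 (e i).2, fun f hf => ?_⟩
    obtain ⟨i, hi⟩ := hD f fun p => by simpa using hf p.castSucc
    obtain ⟨k, hk⟩ := hD' i f hi (by simpa using hf (Fin.last P))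
    exact ⟨e.symm (i, k), by simpa using hk⟩

theorem GluesWith.exists_follows {q : ℕ} (hq : S.GluesWith q) {ε a L : ℝ} (hL : 0 < L) (τ x : ℝ)
    {n P : ℕ} (hP : 0 < P) (s : Fin P → Fin n → S.Ball ε) :
    ∃ G : (Fin n → Fin (q ^ P)) → Fin n → S.Ball ε, ∀ f,
      (∀ p : Fin P, Follows τ a (a + L) (s p) (S.ζ (x + p * L - a) f)) →
        ∃ k, Follows τ x (x + P * L) (G k) f := by
  choose D hD using fun j : Fin n =>
    hq.consecutive hL x hP fun p : Fin P => (s p j).shift (-(x + p * L - a))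
  refine ⟨fun k j => D j (k j), fun f hf => ?_⟩
  have hglue (j : Fin n) : ∃ i, (D j i).Mem x (x + P * L) (S.φ (j * τ) f) := by
    refine hD j _ fun p => ?_
    have hj := (mem_φ_ζ_iff (lt_add_of_pos_right a hL) (j * τ) (x + p * L - a) 0 f (s p j)).1
      (by rw [φ_zero]; exact hf p j)
    convert hj using 1 <;> ring_nf
  choose k hk using hglue
  exact ⟨k, hk⟩

variable (S) in
/-- The phase space is covered by `M` strings of `n` balls of radius `< ε` over `[a, b]`. -/
def HasStringCover (τ ε a b : ℝ) (n M : ℕ) : Prop :=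
  ∃ s : Fin M → Fin n → S.Ball ε, ∀ f, ∃ i, Follows τ a b (s i) f

section

variable {τ ε a b : ℝ} {n M : ℕ}

theorem HasStringCover.of_fintype {ι : Type*} [Fintype ι] (hM : Fintype.card ι = M)
    (s : ι → Fin n → S.Ball ε) (h : ∀ f, ∃ i, Follows τ a b (s i) f) :
    S.HasStringCover τ ε a b n M := by
  let e := Fintype.equivFinOfCardEq hM
  refine ⟨fun i => s (e.symm i), fun f => ?_⟩
  obtain ⟨i, hi⟩ := h f
  exact ⟨e i, by simpa using hi⟩

theorem HasStringCover.mono {a' b' : ℝ} (h : S.HasStringCover τ ε a b n M) (ha : a ≤ a')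
    (hab : a' < b') (hb : b' ≤ b) : S.HasStringCover τ ε a' b' n M := by
  obtain ⟨s, hs⟩ := h
  exact ⟨s, fun f => (hs f).imp fun i hi => hi.mono ha hab hb⟩

theorem HasStringCover.tile {q : ℕ} (hq : S.GluesWith q) {L : ℝ} (hL : 0 < L)
    (h : S.HasStringCover τ ε a (a + L) n M) {P : ℕ} (hP : 0 < P) (x : ℝ) :
    S.HasStringCover τ ε x (x + P * L) n ((M * q ^ n) ^ P) := by
  obtain ⟨s, hs⟩ := h
  choose G hG using fun c : Fin P → Fin M => hq.exists_follows (a := a) hL τ x hP fun p => s (c p)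
  refine .of_fintype (ι := (Fin P → Fin M) × (Fin n → Fin (q ^ P))) ?_ (fun i => G i.1 i.2)
    fun f => ?_
  · simp only [Fintype.card_prod, Fintype.card_fun, Fintype.card_fin]
    rw [mul_pow, ← pow_mul, ← pow_mul, mul_comm P n]
  · choose c hc using fun p : Fin P => hs (S.ζ (x + p * L - a) f)
    obtain ⟨k, hk⟩ := hG c f hc
    exact ⟨(c, k), hk⟩

theorem WindowsCompact.exists_finset_wdist_lt (hA1 : S.WindowsCompact) (hε : 0 < ε)
    (hab : a < b) : ∃ t : Finset S.State, ∀ f, ∃ z ∈ t, S.wdist a b f z < ε := by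
  have := hA1.compactSpace
  obtain ⟨t, ht⟩ := isCompact_univ.elim_finite_subcover
    (fun z : S.State => {g : S.State | S.wdist a b g z < ε}) (fun z => isOpen_wdist_lt hab z ε)
    (fun f _ => mem_iUnion.2 ⟨f, (wdist_self hab f).trans_lt hε⟩)
  refine ⟨t, fun f => ?_⟩
  obtain ⟨z, hz, hf⟩ := mem_iUnion₂.1 (ht (mem_univ f))
  exact ⟨z, hz, hf⟩

theorem WindowsCompact.exists_hasStringCover_one (hA1 : S.WindowsCompact) (τ : ℝ) (hε : 0 < ε)
    (hab : a < b) : ∃ M, S.HasStringCover τ ε a b 1 M := by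
  obtain ⟨t, ht⟩ := hA1.exists_finset_wdist_lt (half_pos hε) hab
  refine ⟨_, .of_fintype (ι := t) rfl
    (fun z _ => ⟨z, ε / 2, half_pos hε, half_lt_self hε⟩) fun f => ?_⟩
  obtain ⟨z, hz, hf⟩ := ht f
  exact ⟨⟨z, hz⟩, fun j => by simpa [Ball.Mem, φ_zero] using hf⟩

end

/-! ### Distinguishable orbits -/

section

variable {a b T ε : ℝ}

theorem Indistinguishable.symm (hab : a < b) {f g : S.State}
    (h : S.Indistinguishable a b T ε f g) : S.Indistinguishable a b T ε g f :=
  fun t ht => by rw [wdist_comm hab]; exact h t ht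

theorem exists_encard_eq_maxOrbits (hN : S.maxOrbits a b T ε ≠ ⊤) :
    ∃ A : Set S.State, A.Pairwise (fun f g => ¬ S.Indistinguishable a b T ε f g) ∧
      A.encard = S.maxOrbits a b T ε := by
  have : Nonempty {A : Set S.State // A.Pairwise fun f g => ¬ S.Indistinguishable a b T ε f g} :=
    ⟨∅, pairwise_empty _⟩
  rw [maxOrbits, iSup_subtype'] at hN ⊢
  obtain ⟨A, hA⟩ := ENat.exists_eq_iSup_of_lt_top (lt_top_iff_ne_top.2 hN)
  exact ⟨A.1, A.2, hA⟩

theorem exists_mem_indistinguishable (hε : 0 < ε) (hab : a < b) (hN : S.maxOrbits a b T ε ≠ ⊤)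
    {A : Set S.State} (hA : A.Pairwise fun f g => ¬ S.Indistinguishable a b T ε f g)
    (hAN : A.encard = S.maxOrbits a b T ε) (f : S.State) :
    ∃ g ∈ A, S.Indistinguishable a b T ε f g := by
  by_contra! hf
  have hfA : f ∉ A := fun h => hf f h fun t _ => by rwa [wdist_self hab]
  have hinsert : (insert f A).encard ≤ S.maxOrbits a b T ε :=
    le_iSup₂_of_le (insert f A)
      (hA.insert_of_notMem hfA fun g hg => ⟨hf g hg, fun h => hf g hg (h.symm hab)⟩) le_rfl
  rw [Set.encard_insert_of_notMem hfA, hAN] at hinsert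
  exact ((ENat.lt_add_one_iff hN).2 le_rfl).not_ge hinsert

theorem hasStringCover_of_maxOrbits {τ : ℝ} (hτ : 0 < τ) (hT : 0 < T) (hε : 0 < ε) (hab : a < b)
    (hN : S.maxOrbits a b T (ε / 2) ≠ ⊤) :
    S.HasStringCover τ ε a b ⌈T / τ⌉₊ (S.maxOrbits a b T (ε / 2)).toNat := by
  obtain ⟨A, hA, hAN⟩ := exists_encard_eq_maxOrbits hN
  have := (Set.encard_ne_top_iff.1 (hAN ▸ hN)).fintype
  -- The sampling times are shifted by `s` so as to lie in the open interval `(0, T)`.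
  set s : ℝ := (T - (⌈T / τ⌉₊ - 1) * τ) / 2 with hs
  have hs0 : (⌈T / τ⌉₊ - 1) * τ < T :=
    (lt_div_iff₀ hτ).1 (sub_lt_iff_lt_add.2 (Nat.ceil_lt_add_one (by positivity)))
  refine .of_fintype (ι := A) ?_
    (fun g j => ⟨S.φ (j * τ + s) g.1, ε / 2, half_pos hε, half_lt_self hε⟩) fun f => ?_
  · rw [← hAN, Set.encard_eq_coe_toFinset_card, ENat.toNat_natCast, Set.toFinset_card]
  · obtain ⟨g, hg, hfg⟩ := exists_mem_indistinguishable (half_pos hε) hab hN hA hAN (S.φ (-s) f)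
    refine ⟨⟨g, hg⟩, fun j => ?_⟩
    have hj : (j : ℝ) * τ ≤ (⌈T / τ⌉₊ - 1) * τ := by
      gcongr
      exact le_sub_iff_add_le.2 (mod_cast j.2)
    have hmem := hfg (j * τ + s)
      ⟨by have : 0 ≤ (j : ℝ) * τ := by positivity
          linarith, by linarith⟩
    rwa [← φ_add, add_neg_cancel_right] at hmem

end

end ExtendedSystem

/-! ### Complexity of concatenations of blocks -/

theorem rePred_mem_range {α β : Type*} [Primcodable α] [Primcodable β] {f : α → β}
    (hf : Computable f) : REPred fun b => b ∈ Set.range f := by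
  classical
  have hdec : Computable₂ fun (b : β) (k : ℕ) =>
      decide (((Encodable.decode k : Option α).map f) = some b) := by
    have heq : Primrec₂ fun x y : Option β => decide (x = y) := Primrec.eq.decide
    exact heq.to_comp.comp
      (Computable.option_map (Computable.decode.comp Computable.snd) (hf.comp Computable.snd).to₂)
      (Computable.option_some.comp Computable.fst)
  refine (Partrec.rfind hdec.partrec₂).dom_re.of_eq fun b => Nat.rfind_dom.trans ?_
  simp only [PFun.coe_val, Part.mem_some_iff, Part.some_dom, implies_true, and_true]
  constructor
  · rintro ⟨k, hk⟩
    obtain ⟨x, -, hx⟩ := Option.map_eq_some_iff.1 (of_decide_eq_true hk.symm)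
    exact ⟨x, hx⟩
  · rintro ⟨x, rfl⟩
    exact ⟨Encodable.encode x, by simp⟩

theorem ncard_setOf_length_eq (r n : ℕ) : {v : List (Fin r) | v.length = n}.ncard = r ^ n := by
  rw [← Nat.card_coe_set_eq]
  exact (Nat.card_eq_fintype_card (α := List.Vector (Fin r) n)).trans (by simp)

theorem logb_two_natCast_nonneg (n : ℕ) : 0 ≤ Real.logb 2 n :=
  div_nonneg (Real.log_natCast_nonneg n) (Real.log_nonneg one_le_two)

namespace ComplexityFunction

variable {K : ComplexityFunction}

theorem logError_le {c : ℝ} {m n : ℕ} (h : m ≤ n) : logError c m ≤ logError |c| n := by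
  have hm : 0 ≤ Real.logb 2 ((m : ℝ) + 1) := mod_cast logb_two_natCast_nonneg (m + 1)
  have hmn : Real.logb 2 ((m : ℝ) + 1) ≤ Real.logb 2 ((n : ℝ) + 1) :=
    Real.logb_le_logb_of_le one_lt_two (by positivity) (by gcongr)
  unfold logError
  calc c * (1 + Real.logb 2 (m + 1)) ≤ |c| * (1 + Real.logb 2 (m + 1)) := by
        gcongr
        exact le_abs_self c
    _ ≤ |c| * (1 + Real.logb 2 (n + 1)) := by gcongr

theorem tendsto_logError_div (c : ℝ) :
    Tendsto (fun n : ℕ => logError c n / n) atTop (𝓝 0) := by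
  have hlog : Tendsto (fun n : ℕ => Real.log ((n : ℝ) + 1) / n) atTop (𝓝 0) := by
    simpa [Function.comp_def] using
      (Real.tendsto_pow_log_div_mul_add_atTop 1 (-1) 1 one_ne_zero).comp
        (tendsto_atTop_add_const_right _ 1 tendsto_natCast_atTop_atTop)
  have hinv : Tendsto (fun n : ℕ => ((n : ℝ))⁻¹) atTop (𝓝 0) :=
    tendsto_inv_atTop_zero.comp tendsto_natCast_atTop_atTop
  have := (hinv.add (hlog.div_const (Real.log 2))).const_mul c
  simp only [zero_div, add_zero, mul_zero] at this
  refine this.congr fun n => ?_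
  unfold logError Real.logb
  ring

theorem Shannon.exists_le_logb_ncard_fiber (hK : K.Shannon) {α : Type*} [Primcodable α] {r : ℕ}
    {w : α → List (Fin r)} {len : α → ℕ} (hw : Computable w) (hlen : Computable len)
    (hfin : ∀ n, {x | len x = n}.Finite) :
    ∃ c : ℝ, ∀ x, (K r (w x) : ℝ) ≤
      Real.logb 2 ({y | len y = len x}.ncard) + logError c (len x) := by
  have hset (n : ℕ) : {s | (s, n) ∈ Set.range fun x => (w x, len x)} = w '' {x | len x = n} := by
    ext s
    simp [and_comm]
  obtain ⟨c, hc⟩ := hK r _ (rePred_mem_range (hw.pair hlen)) fun n => by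
    rw [hset]; exact (hfin n).image w
  refine ⟨c, fun x => (hc (len x) (w x) ⟨x, rfl⟩).trans ?_⟩
  rw [hset]
  have hpos : 0 < (w '' {y | len y = len x}).ncard :=
    (Set.ncard_pos ((hfin _).image w)).2 ⟨w x, x, rfl, rfl⟩
  gcongr
  · exact one_lt_two
  · exact Set.ncard_image_le (hfin _)

theorem Shannon.exists_flatMap_append_le (hK : K.Shannon) {M r : ℕ} {ι : Type*} [Primcodable ι]
    [Finite ι] (w : Fin M → List (Fin r)) (u : ι → List (Fin r)) :
    ∃ c : ℝ, ∀ (v : List (Fin M)) (i : ι),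
      (K r (v.flatMap w ++ u i) : ℝ) ≤ v.length * Real.logb 2 M + logError c v.length := by
  have hset (n : ℕ) : {x : List (Fin M) × ι | x.1.length = n} =
      {v : List (Fin M) | v.length = n} ×ˢ univ := by
    ext; simp
  have hw : Primrec fun x : List (Fin M) × ι => x.1.flatMap w ++ u x.2 :=
    Primrec.list_append.comp
      (Primrec.list_flatMap Primrec.fst ((Primrec.dom_finite w).comp Primrec.snd).to₂)
      ((Primrec.dom_finite u).comp Primrec.snd)
  obtain ⟨c, hc⟩ := hK.exists_le_logb_ncard_fiber hw.to_comp
    (Primrec.list_length.comp Primrec.fst).to_comp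
    fun n => by rw [hset]; exact (List.finite_length_eq _ n).prod finite_univ
  refine ⟨|c| + Real.logb 2 (Nat.card ι), fun v i => (hc (v, i)).trans ?_⟩
  have hι : Nonempty ι := ⟨i⟩
  have hM : M ^ v.length ≠ 0 := by
    rw [← ncard_setOf_length_eq]
    exact Set.ncard_ne_zero_of_mem (a := v) rfl (List.finite_length_eq _ _)
  have hlog : 0 ≤ Real.logb 2 ((v.length : ℝ) + 1) :=
    mod_cast logb_two_natCast_nonneg (v.length + 1)
  have hcard : 0 ≤ Real.logb 2 (Nat.card ι) := logb_two_natCast_nonneg _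
  have herr : logError c v.length ≤ logError |c| v.length := logError_le le_rfl
  dsimp only
  rw [hset, Set.ncard_prod, ncard_setOf_length_eq, Set.ncard_univ, Nat.cast_mul, Nat.cast_pow,
    Real.logb_mul (mod_cast hM) (mod_cast Nat.card_pos.ne'), Real.logb_pow]
  unfold logError at herr ⊢
  nlinarith

theorem Shannon.exists_linear_bound (hK : K.Shannon) (r : ℕ) :
    ∃ B : ℝ≥0, ∀ s : List (Fin r), (K r s : ℝ) ≤ B * (s.length + 1) := by
  obtain ⟨c, hc⟩ := hK.exists_le_logb_ncard_fiber (r := r) Computable.id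
    Primrec.list_length.to_comp fun n => List.finite_length_eq _ n
  refine ⟨(Real.logb 2 r + |c|).toNNReal, fun s => (hc s).trans ?_⟩
  have hr := logb_two_natCast_nonneg r
  have herr : logError c s.length ≤ logError |c| s.length := logError_le le_rfl
  have hlog : Real.logb 2 ((s.length : ℝ) + 1) ≤ s.length := by
    rw [Real.logb_le_iff_le_rpow one_lt_two (by positivity), Real.rpow_natCast]
    exact_mod_cast Nat.lt_two_pow_self (n := s.length)
  rw [ncard_setOf_length_eq, Nat.cast_pow, Real.logb_pow, Real.coe_toNNReal _ (by positivity)]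
  unfold logError at herr ⊢
  nlinarith [mul_le_mul_of_nonneg_left hlog (abs_nonneg c)]

end ComplexityFunction

namespace ExtendedSystem

variable {S : ExtendedSystem} {K : ComplexityFunction}

open ComplexityFunction

/-! ### Upper bound for the complexity of orbits -/

section

variable {ε τ a b : ℝ} {n M : ℕ}

/-- The covering by all balls of a covering family of strings. The letter `finProdFinEquiv (i, j)`
stands for the ball number `j` of the string `i`. -/
def stringCovering (hn : 0 < n) (s : Fin M → Fin n → S.Ball ε)
    (hs : ∀ f, ∃ i, Follows τ a b (s i) f) : S.Covering a b ε where
  card := M * n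
  center i := (s (finProdFinEquiv.symm i).1 (finProdFinEquiv.symm i).2).center
  radius i := (s (finProdFinEquiv.symm i).1 (finProdFinEquiv.symm i).2).radius
  radius_pos i := (s _ _).radius_pos
  radius_lt i := (s _ _).radius_lt
  covers f := by
    obtain ⟨i, hi⟩ := hs f
    exact ⟨finProdFinEquiv (i, ⟨0, hn⟩), by simpa [φ_zero, Ball.Mem] using hi ⟨0, hn⟩⟩

/-- The first `l` letters of the word that codes the string `i`, over the alphabet of
`stringCovering`. -/
def blockWord (i : Fin M) (l : Fin (n + 1)) : List (Fin (M * n)) :=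
  List.ofFn fun j : Fin l => finProdFinEquiv (i, Fin.castLE (Nat.lt_succ_iff.1 l.2) j)

theorem ofFn_eq_flatMap_blockWord (hn : 0 < n) (i : ℕ → Fin M) {N m : ℕ} {l : Fin (n + 1)}
    (hN : N = m * n + l) :
    (List.ofFn fun t : Fin N => finProdFinEquiv (i (t / n), ⟨t % n, Nat.mod_lt _ hn⟩)) =
      (List.ofFn fun k : Fin m => i k).flatMap (blockWord · (Fin.last n)) ++ blockWord (i m) l := by
  subst hN
  have hdiv (k : ℕ) (j : Fin n) : (k * n + j) / n = k := by
    rw [mul_comm, Nat.mul_add_div hn, Nat.div_eq_of_lt j.2, add_zero]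
  have hmod (k : ℕ) (j : Fin n) : (k * n + j) % n = j := by
    rw [mul_comm, Nat.mul_add_mod, Nat.mod_eq_of_lt j.2]
  rw [List.ofFn_add]
  congr 1
  · rw [List.ofFn_mul, List.flatMap, List.map_ofFn]
    simp [blockWord, Function.comp_def, hdiv, hmod]
  · refine congrArg List.ofFn (funext fun j => ?_)
    have hj : (j : ℕ) = (Fin.castLE (Nat.lt_succ_iff.1 l.2) j : Fin n) := rfl
    simp only [Fin.val_natAdd, hj, hdiv, hmod]

theorem follows_concat (hn : 0 < n) (s : Fin M → Fin n → S.Ball ε) {f : S.State} {i : ℕ → Fin M}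
    (hi : ∀ k : ℕ, Follows τ a b (s (i k)) (S.φ (k * n * τ) f)) (N : ℕ) :
    Follows τ a b (fun t : Fin N => s (i (t / n)) ⟨t % n, Nat.mod_lt _ hn⟩) f := by
  intro t
  have ht : ((t % n : ℕ) : ℝ) * τ + ((t / n : ℕ) : ℝ) * n * τ = (t : ℕ) * τ := by
    have : ((n * (t / n) + t % n : ℕ) : ℝ) = (t : ℕ) := by rw [Nat.div_add_mod]
    rw [← this]
    push_cast
    ring
  simpa only [← φ_add, ht] using hi (t / n) ⟨t % n, Nat.mod_lt _ hn⟩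

theorem HasStringCover.pos (h : S.HasStringCover τ ε a b n M) : 0 < M := by
  obtain ⟨s, hs⟩ := h
  obtain ⟨f⟩ : Nonempty S.State := S.nonempty.to_subtype
  obtain ⟨i, -⟩ := hs f
  exact i.pos

theorem exists_orbitComplexity_stringCovering_le (hK : K.Shannon) (hn : 0 < n)
    (s : Fin M → Fin n → S.Ball ε) (hs : ∀ f, ∃ i, Follows τ a b (s i) f) :
    ∃ c : ℝ, ∀ (f : S.State) (N : ℕ), (stringCovering hn s hs).orbitComplexity K τ f N ≤
      ENNReal.ofReal (N / n * Real.logb 2 M + logError c N) := by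
  obtain ⟨c, hc⟩ := hK.exists_flatMap_append_le (blockWord (M := M) · (Fin.last n))
    fun x : Fin M × Fin (n + 1) => blockWord x.1 x.2
  refine ⟨|c|, fun f N => ?_⟩
  choose i hi using fun k : ℕ => hs (S.φ (k * n * τ) f)
  refine (iInf₂_le (fun t : Fin N => finProdFinEquiv (i (t / n), ⟨t % n, Nat.mod_lt _ hn⟩))
    fun t => ?_).trans ?_
  · simpa [stringCovering, Ball.Mem] using follows_concat hn s hi N t
  rw [← ENNReal.ofReal_coe_nnreal]
  refine ENNReal.ofReal_le_ofReal ?_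
  change (K (M * n) (List.ofFn _) : ℝ) ≤ _
  rw [ofFn_eq_flatMap_blockWord hn i (m := N / n)
    (l := ⟨N % n, (Nat.mod_lt N hn).trans n.lt_succ_self⟩) (Nat.div_add_mod' N n).symm]
  refine (hc _ (i (N / n), ⟨N % n, _⟩)).trans ?_
  rw [List.length_ofFn]
  gcongr
  · exact logb_two_natCast_nonneg M
  · exact Nat.cast_div_le
  · exact logError_le (Nat.div_le_self N n)

theorem HasStringCover.windowComplexity_le (hK : K.Shannon) (hn : 0 < n)
    (h : S.HasStringCover τ ε a b n M) (f : S.State) :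
    S.windowComplexity K τ ε a b f ≤ ENNReal.ofReal (Real.logb 2 M / n) := by
  obtain ⟨s, hs⟩ := h
  obtain ⟨c, hc⟩ := exists_orbitComplexity_stringCovering_le hK hn s hs
  have hlim : Tendsto (fun N : ℕ => Real.logb 2 M / n + logError c N / N) atTop
      (𝓝 (Real.logb 2 M / n)) := by
    simpa using (tendsto_logError_div c).const_add (Real.logb 2 M / n)
  refine (iInf_le _ (stringCovering hn s hs)).trans ((limsup_le_limsup ?_).trans_eq
    ((ENNReal.continuous_ofReal.tendsto _).comp hlim).limsup_eq)
  filter_upwards [eventually_gt_atTop 0] with N hN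
  have hN' : (0 : ℝ) < N := mod_cast hN
  calc (stringCovering hn s hs).orbitComplexity K τ f N / N
      ≤ ENNReal.ofReal (N / n * Real.logb 2 M + logError c N) / ENNReal.ofReal N := by
        rw [ENNReal.ofReal_natCast]
        gcongr
        exact hc f N
    _ = ENNReal.ofReal (Real.logb 2 M / n + logError c N / N) := by
        rw [← ENNReal.ofReal_div_of_pos hN']
        congr 1
        field_simp

theorem HasStringCover.windowComplexity_le_of_tile {q : ℕ} (hK : K.Shannon) (hq : S.GluesWith q)
    {x L : ℝ} (hL : 0 < L) (hn : 0 < n) (h : S.HasStringCover τ ε x (x + L) n M) (hab : a < b)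
    (f : S.State) : S.windowComplexity K τ ε a b f ≤
      ENNReal.ofReal (((b - a) / L + 1) * (Real.logb 2 M / n + Real.logb 2 q)) := by
  have hlength : 0 < (b - a) / L := div_pos (sub_pos.2 hab) hL
  have hP : 0 < ⌈(b - a) / L⌉₊ := Nat.ceil_pos.2 hlength
  have hcover : b ≤ a + ⌈(b - a) / L⌉₊ * L := by
    linarith [(div_le_iff₀ hL).1 (Nat.le_ceil ((b - a) / L))]
  refine (((h.tile hq hL hP a).mono le_rfl hab hcover).windowComplexity_le hK hn f).trans
    (ENNReal.ofReal_le_ofReal ?_)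
  have hM : (M : ℝ) ≠ 0 := mod_cast h.pos.ne'
  have hq0 : (q : ℝ) ≠ 0 := mod_cast hq.pos.ne'
  have hlM := logb_two_natCast_nonneg M
  have hlq := logb_two_natCast_nonneg q
  calc Real.logb 2 ((M * q ^ n) ^ ⌈(b - a) / L⌉₊ : ℕ) / n
      = ⌈(b - a) / L⌉₊ * (Real.logb 2 M / n + Real.logb 2 q) := by
        push_cast
        rw [Real.logb_pow, Real.logb_mul hM (pow_ne_zero _ hq0), Real.logb_pow]
        field_simp
    _ ≤ ((b - a) / L + 1) * (Real.logb 2 M / n + Real.logb 2 q) := by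
        gcongr
        exact (Nat.ceil_lt_add_one hlength.le).le

theorem HasStringCover.pointComplexity_le {q : ℕ} (hK : K.Shannon) (hq : S.GluesWith q)
    {x L : ℝ} (hL : 0 < L) (hn : 0 < n) (h : S.HasStringCover τ ε x (x + L) n M) {a b : ℕ → ℝ}
    (hab : Tendsto (fun k => b k - a k) atTop atTop) (f : S.State) :
    S.pointComplexity K τ ε a b f ≤ ENNReal.ofReal ((Real.logb 2 M / n + Real.logb 2 q) / L) := by
  set D := Real.logb 2 M / n + Real.logb 2 q
  have hlim : Tendsto (fun k => (1 / L + (b k - a k)⁻¹) * D) atTop (𝓝 (D / L)) := by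
    simpa [div_eq_inv_mul] using
      ((tendsto_inv_atTop_zero.comp hab).const_add (1 / L)).mul_const D
  refine (limsup_le_limsup ?_).trans_eq ((ENNReal.continuous_ofReal.tendsto _).comp hlim).limsup_eq
  filter_upwards [hab.eventually_gt_atTop 0] with k hk
  calc S.windowComplexity K τ ε (a k) (b k) f / ENNReal.ofReal (b k - a k)
      ≤ ENNReal.ofReal (((b k - a k) / L + 1) * D) / ENNReal.ofReal (b k - a k) := by
        gcongr
        exact h.windowComplexity_le_of_tile hK hq hL hn (sub_pos.1 hk) f
    _ = ENNReal.ofReal ((1 / L + (b k - a k)⁻¹) * D) := by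
        rw [← ENNReal.ofReal_div_of_pos hk]
        congr 1
        field_simp

end

theorem exists_windowComplexity_le (hA1 : S.WindowsCompact) (hA2 : S.BallsGlue) (hK : K.Shannon)
    (τ : ℝ) {ε : ℝ} (hε : 0 < ε) :
    ∃ B : ℝ≥0, ∀ a b : ℝ, a < b → ∀ f : S.State,
      S.windowComplexity K τ ε a b f ≤ B * ENNReal.ofReal (b - a + 1) := by
  obtain ⟨q, hq⟩ := hA2.exists_gluesWith
  obtain ⟨M, hM⟩ := hA1.exists_hasStringCover_one τ hε (by norm_num : (0 : ℝ) < 0 + 1)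
  refine ⟨(Real.logb 2 M + Real.logb 2 q).toNNReal, fun a b hab f => ?_⟩
  refine (hM.windowComplexity_le_of_tile hK hq one_pos one_pos hab f).trans_eq ?_
  rw [div_one, Nat.cast_one, div_one, mul_comm, ENNReal.ofReal_mul]
  · rfl
  · exact add_nonneg (logb_two_natCast_nonneg M) (logb_two_natCast_nonneg q)

theorem exists_hasStringCover_of_lowerTopEntropy_lt {τ ε c : ℝ} (hτ : 0 < τ) (hε : 0 < ε)
    (hc : S.lowerTopEntropy < ENNReal.ofReal c) (L₁ : ℝ) :
    ∃ (a L : ℝ) (n M : ℕ), 0 < L ∧ L₁ ≤ L ∧ 0 < n ∧ S.HasStringCover τ ε a (a + L) n M ∧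
      Real.logb 2 M / n ≤ c * τ * L := by
  have hc0 : 0 < c := ENNReal.ofReal_pos.1 (bot_le.trans_lt hc)
  obtain ⟨⟨a, b⟩, hΛ, hL : max L₁ 1 ≤ b - a⟩ := ((frequently_lt_of_liminf_lt (by isBoundedDefault)
    ((le_iSup₂ (f := fun (ε : ℝ) (_ : 0 < ε) => _) (ε / 2) (half_pos hε)).trans_lt
      hc)).and_eventually (tendsto_comap.eventually (eventually_ge_atTop (max L₁ 1)))).exists
  have hL0 : 0 < b - a := one_pos.trans_le ((le_max_right _ _).trans hL)
  rw [ENNReal.div_lt_iff (Or.inl (by simpa using hL0)) (Or.inl ENNReal.ofReal_ne_top),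
    ← ENNReal.ofReal_mul hc0.le] at hΛ
  obtain ⟨T, hT, hT0⟩ := ((frequently_lt_of_liminf_lt (by isBoundedDefault) hΛ).and_eventually
    (eventually_gt_atTop 0)).exists
  rw [ENNReal.div_lt_iff (Or.inl (by simpa using hT0)) (Or.inl ENNReal.ofReal_ne_top),
    ← ENNReal.ofReal_mul (by positivity)] at hT
  have hN : S.maxOrbits a b T (ε / 2) ≠ ⊤ := by
    intro h
    rw [h, log₂card, if_pos rfl] at hT
    exact not_top_lt hT
  rw [log₂card, if_neg hN, ENNReal.ofReal_lt_ofReal_iff (by positivity)] at hT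
  have hn : 0 < ⌈T / τ⌉₊ := Nat.ceil_pos.2 (by positivity)
  refine ⟨a, b - a, ⌈T / τ⌉₊, (S.maxOrbits a b T (ε / 2)).toNat, hL0, (le_max_left _ _).trans hL,
    hn, ?_, ?_⟩
  · rw [add_sub_cancel]
    exact hasStringCover_of_maxOrbits hτ hT0 hε (sub_pos.1 hL0) hN
  · rw [div_le_iff₀ (mod_cast hn)]
    calc Real.logb 2 (S.maxOrbits a b T (ε / 2)).toNat ≤ c * (b - a) * T := hT.le
      _ ≤ c * (b - a) * (⌈T / τ⌉₊ * τ) := by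
        gcongr
        exact (div_le_iff₀ hτ).1 (Nat.le_ceil _)
      _ = c * τ * (b - a) * ⌈T / τ⌉₊ := by ring

theorem pointComplexity_le_of_lowerTopEntropy_lt (hA2 : S.BallsGlue) (hK : K.Shannon) {τ ε c : ℝ}
    (hτ : 0 < τ) (hε : 0 < ε) {a b : ℕ → ℝ} (hab : Tendsto (fun k => b k - a k) atTop atTop)
    (hc : S.lowerTopEntropy < ENNReal.ofReal c) (f : S.State) :
    S.pointComplexity K τ ε a b f ≤ ENNReal.ofReal (c * τ) := by
  obtain ⟨q, hq⟩ := hA2.exists_gluesWith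
  have hlim : Tendsto (fun m : ℕ => c * τ + Real.logb 2 q / m) atTop (𝓝 (c * τ)) := by
    simpa using (tendsto_const_div_atTop_nhds_zero_nat (Real.logb 2 q)).const_add (c * τ)
  refine ge_of_tendsto ((ENNReal.continuous_ofReal.tendsto _).comp hlim) ?_
  filter_upwards [eventually_gt_atTop 0] with m hm
  obtain ⟨x, L, n, M, hL, hmL, hn, hcover, hM⟩ :=
    exists_hasStringCover_of_lowerTopEntropy_lt hτ hε hc m
  have hlq := logb_two_natCast_nonneg q
  refine (hcover.pointComplexity_le hK hq hL hn hab f).trans (ENNReal.ofReal_le_ofReal ?_)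
  rw [add_div]
  exact add_le_add ((div_le_iff₀ hL).2 hM) (by gcongr)

theorem measureComplexity_le_lowerTopEntropy (hA2 : S.BallsGlue) (hK : K.Shannon) {τ : ℝ}
    (hτ : 0 < τ) {a b : ℕ → ℝ} (hab : Tendsto (fun k => b k - a k) atTop atTop)
    (μ : Measure S.State) [IsProbabilityMeasure μ] :
    S.measureComplexity K τ a b μ ≤ S.lowerTopEntropy := by
  refine le_of_forall_gt fun x hx => ?_
  obtain ⟨c, hc, hcx⟩ := ENNReal.lt_iff_exists_nnreal_btwn.1 hx
  refine lt_of_le_of_lt ?_ hcx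
  rw [← ENNReal.ofReal_coe_nnreal] at hc ⊢
  rw [measureComplexity, ENNReal.div_le_iff (by simpa using hτ) ENNReal.ofReal_ne_top,
    ← ENNReal.ofReal_mul (NNReal.coe_nonneg c)]
  refine iSup₂_le fun ε hε => (lintegral_mono fun f =>
    pointComplexity_le_of_lowerTopEntropy_lt hA2 hK hτ hε hab hc f).trans ?_
  simp

end ExtendedSystem

/-! ### Means and invariant measures -/

section Mean

variable {ι A X Y : Type*} {f g : X → ℝ} {m : (X → ℝ) → ℝ}

/-- Boundedness of a real function, the domain of definition of a mean. -/
def BddFun (f : X → ℝ) : Prop := ∃ C : ℝ, ∀ x, |f x| ≤ C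

theorem BddFun.add (hf : BddFun f) (hg : BddFun g) : BddFun (f + g) := by
  obtain ⟨C, hC⟩ := hf
  obtain ⟨D, hD⟩ := hg
  exact ⟨C + D, fun x => (abs_add_le _ _).trans (add_le_add (hC x) (hD x))⟩

theorem BddFun.smul (c : ℝ) (hf : BddFun f) : BddFun (c • f) := by
  obtain ⟨C, hC⟩ := hf
  refine ⟨|c| * C, fun x => ?_⟩
  simpa [abs_mul] using mul_le_mul_of_nonneg_left (hC x) (abs_nonneg c)

theorem BddFun.comp (hf : BddFun f) (u : Y → X) : BddFun fun y => f (u y) :=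
  hf.imp fun _ hC y => hC (u y)

theorem bddFun_of_continuous [TopologicalSpace X] [CompactSpace X] (hf : Continuous f) :
    BddFun f := by
  obtain ⟨C, hC⟩ := isCompact_univ.exists_bound_of_continuousOn hf.continuousOn
  exact ⟨C, fun x => hC x (mem_univ x)⟩

/-- A mean: a linear functional on bounded functions lying between infimum and supremum. Its values
on unbounded functions are junk. -/
structure IsMean (m : (X → ℝ) → ℝ) : Prop where
  add : ∀ f g, BddFun f → BddFun g → m (f + g) = m f + m g
  smul : ∀ (c : ℝ) f, BddFun f → m (c • f) = c * m f
  le_of_forall_le : ∀ (c : ℝ) f, BddFun f → (∀ x, c ≤ f x) → c ≤ m f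

namespace IsMean

theorem le_of_forall_ge (hm : IsMean m) {c : ℝ} (hf : BddFun f) (h : ∀ x, f x ≤ c) : m f ≤ c := by
  have hneg := hm.le_of_forall_le (-c) ((-1 : ℝ) • f) (hf.smul _) fun x => by simpa using h x
  rw [hm.smul _ _ hf] at hneg
  linarith

theorem sub (hm : IsMean m) (hf : BddFun f) (hg : BddFun g) :
    m (fun x => f x - g x) = m f - m g := by
  have hsub : (fun x => f x - g x) = f + (-1 : ℝ) • g := by
    ext x
    simp [sub_eq_add_neg]
  rw [hsub, hm.add _ _ hf (hg.smul _), hm.smul _ _ hg]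
  ring

theorem abs_le (hm : IsMean m) {C : ℝ} (h : ∀ x, |f x| ≤ C) : |m f| ≤ C :=
  _root_.abs_le.2 ⟨hm.le_of_forall_le _ _ ⟨C, h⟩ fun x => (_root_.abs_le.1 (h x)).1,
    hm.le_of_forall_ge ⟨C, h⟩ fun x => (_root_.abs_le.1 (h x)).2⟩

theorem map (hm : IsMean m) (u : X → Y) : IsMean fun F : Y → ℝ => m fun x => F (u x) where
  add _ _ hf hg := hm.add _ _ (hf.comp u) (hg.comp u)
  smul c _ hf := hm.smul c _ (hf.comp u)
  le_of_forall_le c _ hf h := hm.le_of_forall_le c _ (hf.comp u) fun x => h (u x)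

theorem bddFun_apply {J : A → (X → ℝ) → ℝ} (hJ : ∀ a, IsMean (J a)) (hf : BddFun f) :
    BddFun fun a => J a f :=
  hf.imp fun _ hC a => (hJ a).abs_le hC

theorem bind {m : (A → ℝ) → ℝ} (hm : IsMean m) {J : A → (X → ℝ) → ℝ} (hJ : ∀ a, IsMean (J a)) :
    IsMean fun f => m fun a => J a f where
  add f g hf hg := by
    rw [← hm.add _ _ (bddFun_apply hJ hf) (bddFun_apply hJ hg)]
    exact congrArg m (funext fun a => (hJ a).add f g hf hg)
  smul c f hf := by
    rw [← hm.smul _ _ (bddFun_apply hJ hf)]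
    exact congrArg m (funext fun a => (hJ a).smul c f hf)
  le_of_forall_le c f hf h :=
    hm.le_of_forall_le _ _ (bddFun_apply hJ hf) fun a => (hJ a).le_of_forall_le c f hf h

end IsMean

theorem isMean_eval (x : X) : IsMean fun f => f x where
  add _ _ _ _ := rfl
  smul _ _ _ := rfl
  le_of_forall_le _ _ _ h := h x

theorem isMean_expect {s : Finset X} (hs : s.Nonempty) : IsMean fun f => 𝔼 x ∈ s, f x where
  add f g _ _ := Finset.expect_add_distrib s f g
  smul c f _ := (Finset.mul_expect s f c).symm
  le_of_forall_le _ _ _ h := Finset.le_expect hs fun x _ => h x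

/-- The limit of a bounded family of reals along an ultrafilter. -/
def ultraLim (u : Ultrafilter X) (f : X → ℝ) : ℝ := limUnder (u : Filter X) f

theorem tendsto_ultraLim (u : Ultrafilter X) (hf : BddFun f) :
    Tendsto f u (𝓝 (ultraLim u f)) := by
  obtain ⟨C, hC⟩ := hf
  obtain ⟨l, -, hl⟩ := (isCompact_Icc (a := -C) (b := C)).ultrafilter_le_nhds (u.map f)
    (le_principal_iff.2 (mem_map.2 (univ_mem' fun x => abs_le.1 (hC x))))
  exact tendsto_nhds_limUnder ⟨l, hl⟩

theorem isMean_ultraLim (u : Ultrafilter X) : IsMean (ultraLim u) where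
  add _ _ hf hg := tendsto_nhds_unique (tendsto_ultraLim u (hf.add hg))
    ((tendsto_ultraLim u hf).add (tendsto_ultraLim u hg))
  smul c _ hf := tendsto_nhds_unique (tendsto_ultraLim u (hf.smul c))
    ((tendsto_ultraLim u hf).const_mul c)
  le_of_forall_le _ _ hf h := ge_of_tendsto' (tendsto_ultraLim u hf) h

end Mean

section InvariantMean

variable {A : Type*} [AddCommGroup A]

/-- The average of `f` along the segment `x, x + a, …, x + M a`. -/
def segmentAverage (M : ℕ) (a : A) (f : A → ℝ) (x : A) : ℝ :=
  𝔼 i ∈ Finset.range (M + 1), f (x + i • a)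

theorem segmentAverage_comm (M : ℕ) (a b : A) (f : A → ℝ) :
    segmentAverage M a (segmentAverage M b f) = segmentAverage M b (segmentAverage M a f) := by
  ext x
  simp only [segmentAverage]
  rw [Finset.expect_comm]
  simp only [add_right_comm]

theorem abs_segmentAverage_sub_le (M : ℕ) (a : A) {C : ℝ} {f : A → ℝ} (h : ∀ x, |f x| ≤ C)
    (x : A) : |segmentAverage M a (fun y => f (y + a) - f y) x| ≤ 2 * C / (M + 1) := by
  have htelescope : ∑ i ∈ Finset.range (M + 1), (f (x + i • a + a) - f (x + i • a)) =
      f (x + (M + 1) • a) - f x := by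
    simpa [succ_nsmul, add_assoc] using Finset.sum_range_sub (fun i => f (x + i • a)) (M + 1)
  rw [segmentAverage, Finset.expect_eq_sum_div_card, htelescope, abs_div, Finset.card_range,
    Nat.abs_cast, Nat.cast_succ]
  gcongr
  linarith [abs_sub (f (x + (M + 1) • a)) (f x), h (x + (M + 1) • a), h x]

/-- Average over the box spanned by a list of vectors. -/
def boxAverage (M : ℕ) (l : List A) (f : A → ℝ) : A → ℝ :=
  l.foldr (segmentAverage M) f

theorem isMean_boxAverage (M : ℕ) (l : List A) (x : A) : IsMean fun f => boxAverage M l f x := by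
  induction l generalizing x with
  | nil => exact isMean_eval x
  | cons a l ih =>
    exact (isMean_expect Finset.nonempty_range_add_one).bind fun i : ℕ => ih (x + i • a)

theorem abs_boxAverage_sub_le (M : ℕ) {l : List A} {a : A} (ha : a ∈ l) {C : ℝ} {f : A → ℝ}
    (h : ∀ x, |f x| ≤ C) (x : A) :
    |boxAverage M l (fun y => f (y + a) - f y) x| ≤ 2 * C / (M + 1) := by
  classical
  have hcomm : LeftCommutative (segmentAverage M : A → (A → ℝ) → A → ℝ) :=
    ⟨segmentAverage_comm M⟩
  have hperm : l.Perm (l.erase a ++ [a]) :=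
    (List.perm_cons_erase ha).trans (List.perm_append_singleton a _).symm
  rw [boxAverage, hperm.foldr_eq, List.foldr_append]
  exact (isMean_boxAverage M (l.erase a) x).abs_le (abs_segmentAverage_sub_le M a h)

variable (A) in
theorem exists_invariant_mean : ∃ m : (A → ℝ) → ℝ, IsMean m ∧
    ∀ f, BddFun f → ∀ a, m (fun x => f (x + a)) = m f := by
  classical
  let u : Ultrafilter (Finset A × ℕ) := Ultrafilter.of atTop
  have hJ (i : Finset A × ℕ) : IsMean fun f : A → ℝ => boxAverage i.2 i.1.toList f 0 :=
    isMean_boxAverage _ _ _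
  have hm := (isMean_ultraLim u).bind hJ
  refine ⟨_, hm, fun f hf a => sub_eq_zero.1 ?_⟩
  rw [← hm.sub (hf.comp _) hf]
  obtain ⟨C, hC⟩ := hf
  have hbdd : BddFun fun x => f (x + a) - f x :=
    ⟨C + C, fun x => (abs_sub _ _).trans (add_le_add (hC _) (hC _))⟩
  refine tendsto_nhds_unique (tendsto_ultraLim u (IsMean.bddFun_apply hJ hbdd))
    (Tendsto.mono_left ?_ (Ultrafilter.of_le _))
  have hlim : Tendsto (fun i : Finset A × ℕ => 2 * C / ((i.2 : ℝ) + 1)) atTop (𝓝 0) := by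
    rw [← prod_atTop_atTop_eq]
    exact tendsto_const_nhds.div_atTop (tendsto_atTop_add_const_right _ _
      (tendsto_natCast_atTop_atTop.comp tendsto_snd))
  refine squeeze_zero_norm' ?_ hlim
  filter_upwards [eventually_ge_atTop (({a} : Finset A), 0)] with i hi
  exact abs_boxAverage_sub_le i.2 (Finset.mem_toList.2 (hi.1 (Finset.mem_singleton_self a))) hC 0

end InvariantMean

section InvariantMeasure

variable {A X : Type*} [TopologicalSpace X] [T2Space X] [CompactSpace X] [MeasurableSpace X]
  [BorelSpace X]

theorem IsMean.exists_measure {m : (X → ℝ) → ℝ} (hm : IsMean m) :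
    ∃ μ : Measure X, IsProbabilityMeasure μ ∧
      ∀ F : X → ℝ, Continuous F → ∫ x, F x ∂μ = m F := by
  let l : CompactlySupportedContinuousMap X ℝ →ₗ[ℝ] ℝ :=
    { toFun := fun F => m F
      map_add' := fun F G =>
        hm.add F G (bddFun_of_continuous F.continuous) (bddFun_of_continuous G.continuous)
      map_smul' := fun c F => hm.smul c F (bddFun_of_continuous F.continuous) }
  let Λ : CompactlySupportedContinuousMap X ℝ →ₚ[ℝ] ℝ := PositiveLinearMap.mk₀ l
    fun F hF => hm.le_of_forall_le 0 _ (bddFun_of_continuous F.continuous) hF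
  have hint (F : X → ℝ) (hF : Continuous F) : ∫ x, F x ∂(RealRMK.rieszMeasure Λ) = m F :=
    RealRMK.integral_rieszMeasure Λ ⟨⟨F, hF⟩, HasCompactSupport.of_compactSpace F⟩
  refine ⟨RealRMK.rieszMeasure Λ, ⟨?_⟩, hint⟩
  have hone : m (fun _ => 1) = 1 :=
    le_antisymm (hm.le_of_forall_ge (bddFun_of_continuous continuous_const) fun _ => le_rfl)
      (hm.le_of_forall_le _ _ (bddFun_of_continuous continuous_const) fun _ => le_rfl)
  have hmass := hint (fun _ => 1) continuous_const
  rwa [hone, integral_const, smul_eq_mul, mul_one, measureReal_def,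
    ENNReal.toReal_eq_one_iff] at hmass

theorem exists_invariant_measure [TopologicalSpace.PseudoMetrizableSpace X] [AddCommGroup A]
    [AddAction A X] [ContinuousConstVAdd A X] {J : ℕ → (X → ℝ) → ℝ} (hJ : ∀ j, IsMean (J j)) :
    ∃ μ : Measure X, IsProbabilityMeasure μ ∧ (∀ a : A, MeasurePreserving (a +ᵥ ·) μ μ) ∧
      ∀ (F : X → ℝ) (c : ℝ), Continuous F →
        (∀ a : A, ∀ η > 0, ∀ᶠ j in atTop, c - η ≤ J j fun x => F (a +ᵥ x)) →
          c ≤ ∫ x, F x ∂μ := by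
  -- An ultrafilter limit of the means, averaged over the orbits by an invariant mean on the group.
  let u : Ultrafilter ℕ := Ultrafilter.of atTop
  have hlim := (isMean_ultraLim u).bind hJ
  obtain ⟨m, hm, hinv⟩ := exists_invariant_mean A
  have htranslate (a : A) := hlim.map (a +ᵥ · : X → X)
  obtain ⟨μ, hμ, hint⟩ := (hm.bind htranslate).exists_measure
  have hbdd (F : X → ℝ) (hF : Continuous F) :=
    IsMean.bddFun_apply htranslate (bddFun_of_continuous hF)
  refine ⟨μ, hμ, fun a => ⟨(continuous_const_vadd a).measurable, ?_⟩, fun F c hF h => ?_⟩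
  · have hmeas : AEMeasurable (a +ᵥ · : X → X) μ := (continuous_const_vadd a).aemeasurable
    have := Measure.isProbabilityMeasure_map hmeas
    refine ext_of_forall_integral_eq_of_IsFiniteMeasure fun F => ?_
    rw [integral_map hmeas F.continuous.aestronglyMeasurable,
      hint (fun x => F (a +ᵥ x)) (F.continuous.comp (continuous_const_vadd a)),
      hint _ F.continuous, ← hinv _ (hbdd _ F.continuous) a]
    simp only [add_comm _ a, add_vadd]
  · rw [hint F hF]
    refine hm.le_of_forall_le _ _ (hbdd F hF) fun a => le_of_forall_pos_sub_le fun η hη => ?_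
    exact ge_of_tendsto
      (tendsto_ultraLim u (IsMean.bddFun_apply hJ ((bddFun_of_continuous hF).comp (a +ᵥ ·))))
      (Ultrafilter.of_le _ (h a η hη))

end InvariantMeasure

/-! ### Kraft sums -/

/-- The Kraft sum of a code in which the code word `ω` has length `cost ω`. -/
def kraftSum {Ω : Type*} [Fintype Ω] (cost : Ω → ℝ) : ℝ := ∑ ω, (2 : ℝ) ^ (-cost ω)

theorem kraftSum_pi {ι Ω : Type*} [Fintype ι] [DecidableEq ι] [Fintype Ω] (cost : Ω → ℝ) :
    kraftSum (fun w : ι → Ω => ∑ x, cost (w x)) = kraftSum cost ^ Fintype.card ι := by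
  simp only [kraftSum, ← Finset.sum_neg_distrib, Real.rpow_sum_of_pos two_pos]
  rw [← Fintype.prod_sum fun (_ : ι) (ω : Ω) => (2 : ℝ) ^ (-cost ω), Finset.prod_const,
    Finset.card_univ]

theorem card_mul_logb_le_sum_add {X : Type*} (E : Finset X) (h : X → ℝ) {B : ℝ}
    (hB : ∑ f ∈ E, (2 : ℝ) ^ (-h f) ≤ B) :
    E.card * Real.logb 2 E.card ≤ ∑ f ∈ E, (h f + Real.logb 2 B) := by
  rcases E.eq_empty_or_nonempty with rfl | hE
  · simp
  have hcard : (0 : ℝ) < E.card := mod_cast hE.card_pos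
  have hB0 : 0 < B :=
    (Finset.sum_pos (fun f _ => Real.rpow_pos_of_pos two_pos _) hE).trans_le hB
  set s := Real.logb 2 E.card - Real.logb 2 B with hs
  have h2s : (2 : ℝ) ^ s = E.card / B := by
    rw [hs, ← Real.logb_div hcard.ne' hB0.ne',
      Real.rpow_logb two_pos (by norm_num) (div_pos hcard hB0)]
  -- The convexity inequality `1 + u ≤ exp u` at `u = (s - h f) log 2`
  have hexp (f : X) : 1 + Real.log 2 * (s - h f) ≤ (2 : ℝ) ^ s * (2 : ℝ) ^ (-h f) := by
    rw [← Real.rpow_add two_pos, Real.rpow_def_of_pos two_pos, ← sub_eq_add_neg]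
    linarith [Real.add_one_le_exp (Real.log 2 * (s - h f))]
  have hsum : ∑ f ∈ E, (1 + Real.log 2 * (s - h f)) ≤ E.card :=
    calc _ ≤ ∑ f ∈ E, (2 : ℝ) ^ s * (2 : ℝ) ^ (-h f) := Finset.sum_le_sum fun f _ => hexp f
      _ ≤ E.card / B * B := by
        rw [← Finset.mul_sum, h2s]
        gcongr
      _ = E.card := by field_simp
  rw [Finset.sum_add_distrib, ← Finset.mul_sum, Finset.sum_sub_distrib] at hsum
  simp only [Finset.sum_const, nsmul_eq_mul, mul_one] at hsum
  have hmean : Real.log 2 * (E.card * s - ∑ f ∈ E, h f) ≤ 0 := by linarith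
  have := nonpos_of_mul_nonpos_right hmean (Real.log_pos one_lt_two)
  rw [Finset.sum_add_distrib, Finset.sum_const, nsmul_eq_mul]
  linarith

theorem card_mul_logb_le_sum_code {X ι κ Ω : Type*} [Fintype ι] [Fintype κ] [Fintype Ω]
    (cost : Ω → ℝ) (E : Finset X) (w : X → ι → Ω) (k : X → κ)
    (hinj : InjOn (fun f => (w f, k f)) E) :
    E.card * Real.logb 2 E.card ≤ ∑ f ∈ E, (∑ x, cost (w f x) +
      (Fintype.card ι * Real.logb 2 (kraftSum cost) + Real.logb 2 (Fintype.card κ))) := by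
  classical
  rcases E.eq_empty_or_nonempty with rfl | hE
  · simp
  have hle : ∑ f ∈ E, (2 : ℝ) ^ (-∑ x, cost (w f x)) ≤
      kraftSum cost ^ Fintype.card ι * Fintype.card κ :=
    calc ∑ f ∈ E, (2 : ℝ) ^ (-∑ x, cost (w f x))
        = ∑ y ∈ E.image fun f => (w f, k f), (2 : ℝ) ^ (-∑ x, cost (y.1 x)) := by
          rw [Finset.sum_image hinj]
      _ ≤ ∑ y : (ι → Ω) × κ, (2 : ℝ) ^ (-∑ x, cost (y.1 x)) :=
          Finset.sum_le_univ_sum_of_nonneg fun y => (Real.rpow_pos_of_pos two_pos _).le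
      _ = kraftSum cost ^ Fintype.card ι * Fintype.card κ := by
          rw [← kraftSum_pi, kraftSum, Finset.sum_mul]
          simp only [Fintype.sum_prod_type, Finset.sum_const, Finset.card_univ, nsmul_eq_mul,
            mul_comm]
  have hpos : kraftSum cost ^ Fintype.card ι * Fintype.card κ ≠ 0 :=
    ((Finset.sum_pos (fun f _ => Real.rpow_pos_of_pos two_pos _) hE).trans_le hle).ne'
  rw [← Real.logb_pow _ (kraftSum cost), ← Real.logb_mul (left_ne_zero_of_mul hpos)
    (right_ne_zero_of_mul hpos)]
  exact card_mul_logb_le_sum_add E _ hle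

/-- The overhead of a code for the strings of `n` balls in a tile: the logarithm of its Kraft sum,
and `log q` for each of the `n` gluings with the next tile. -/
def overhead {Ω : Type*} [Fintype Ω] (q n : ℕ) (cost : Ω → ℝ) : ℝ :=
  Real.logb 2 (kraftSum cost) + n * Real.logb 2 q

namespace ExtendedSystem

variable {S : ExtendedSystem}

/-! ### Coding of distinguishable orbits by arrays of tiles -/

/-- Every orbit follows over `[a, b]` one of the strings `s ω`, of cost at most `G`. -/
def CodesWithin {ε : ℝ} {n : ℕ} {Ω : Type*} (τ a b : ℝ) (s : Ω → Fin n → S.Ball ε)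
    (cost : Ω → ℝ) (G : S.State → ℝ) : Prop :=
  ∀ f, ∃ ω, Follows τ a b (s ω) f ∧ cost ω ≤ G f

theorem Ball.Mem.wdist_lt {a b ε : ℝ} {B : S.Ball ε} {f g : S.State} (hf : B.Mem a b f)
    (hg : B.Mem a b g) (hab : a < b) : S.wdist a b f g < 2 * ε := by
  have htri := wdist_triangle hab f B.center g
  rw [wdist_comm hab B.center g] at htri
  linarith [B.radius_lt, show S.wdist a b f B.center < B.radius from hf,
    show S.wdist a b g B.center < B.radius from hg]

section

variable {q L n : ℕ} {τ ε a : ℝ} {Ω : Type*} {s : Ω → Fin n → S.Ball ε} {cost : Ω → ℝ}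
  {G : S.State → ℝ}

theorem CodesWithin.exists_array (hG : CodesWithin τ a (a + L) s cost G) (hq : S.GluesWith q)
    (hL : 0 < L) {P : ℕ} (hP : 0 < P) (Q : ℕ) (x t : ℝ) :
    ∃ (w : S.State → Fin P × Fin Q → Ω)
      (B : (Fin P × Fin Q → Ω) → (Fin Q → Fin n → Fin (q ^ P)) → Fin Q → Fin n → S.Ball ε)
      (k : S.State → Fin Q → Fin n → Fin (q ^ P)),
      (∀ f y, cost (w f y) ≤ G (S.ζ (x + y.1 * L - a) (S.φ (t + y.2 * n * τ) f))) ∧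
      ∀ f i, Follows τ x (x + P * L) (B (w f) (k f) i) (S.φ (t + i * n * τ) f) := by
  have hL' : (0 : ℝ) < L := mod_cast hL
  choose ω hω hcost using hG
  choose D hD using fun (v : Fin P × Fin Q → Ω) (i : Fin Q) =>
    hq.exists_follows (a := a) hL' τ x hP fun p => s (v (p, i))
  let w (f : S.State) (y : Fin P × Fin Q) : Ω :=
    ω (S.ζ (x + y.1 * L - a) (S.φ (t + y.2 * n * τ) f))
  choose k hk using fun f i => hD (w f) i (S.φ (t + i * n * τ) f) fun p => hω _
  exact ⟨w, fun v l i => D v i (l i), k, fun f y => hcost _, hk⟩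

theorem CodesWithin.card_mul_logb_le_sum_array [Fintype Ω]
    (hG : CodesWithin τ a (a + L) s cost G) (hq : S.GluesWith q) (hL : 0 < L) {P : ℕ} (hP : 0 < P)
    (Q : ℕ) (x t : ℝ) (E : Finset S.State)
    (hE : ∀ f ∈ E, ∀ g ∈ E, (∀ k < Q * n, S.wdist x (x + P * L) (S.φ (t + k * τ) f)
      (S.φ (t + k * τ) g) < 2 * ε) → f = g) :
    E.card * Real.logb 2 E.card ≤ ∑ f ∈ E, ∑ p ∈ Finset.range P, ∑ i ∈ Finset.range Q,
      (G (S.ζ (x + p * L - a) (S.φ (t + i * n * τ) f)) + overhead q n cost) := by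
  obtain ⟨w, B, k, hcost, hB⟩ := hG.exists_array hq hL hP Q x t
  have hx : x < x + P * L := by
    have : (0 : ℝ) < P * L := mod_cast Nat.mul_pos hP hL
    linarith
  have hinj : InjOn (fun f => (w f, k f)) E := by
    intro f hf g hg hfg
    obtain ⟨hw, hk⟩ := Prod.mk.inj hfg
    refine hE f hf g hg fun m hm => ?_
    have hn : 0 < n := Nat.pos_of_ne_zero (by rintro rfl; simp at hm)
    let i : Fin Q := ⟨m / n, Nat.div_lt_of_lt_mul (by rwa [mul_comm])⟩
    let j : Fin n := ⟨m % n, Nat.mod_lt _ hn⟩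
    have htime : (j : ℝ) * τ + (t + i * n * τ) = t + m * τ := by
      have : ((n * (m / n) + m % n : ℕ) : ℝ) = m := by rw [Nat.div_add_mod]
      push_cast at this
      simp only [i, j, ← this]
      ring
    rw [← htime, φ_add (j * τ), φ_add (j * τ)]
    exact (hB f i j).wdist_lt (hw ▸ hk ▸ hB g i j) hx
  refine (card_mul_logb_le_sum_code cost E w k hinj).trans (Finset.sum_le_sum fun f _ => ?_)
  calc ∑ y, cost (w f y) + (Fintype.card (Fin P × Fin Q) * Real.logb 2 (kraftSum cost) +
        Real.logb 2 (Fintype.card (Fin Q → Fin n → Fin (q ^ P))))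
      = ∑ y, (cost (w f y) + overhead q n cost) := by
        rw [Finset.sum_add_distrib, Finset.sum_const, Finset.card_univ, nsmul_eq_mul, overhead]
        simp only [Fintype.card_prod, Fintype.card_fun, Fintype.card_fin]
        push_cast
        rw [Real.logb_pow, Real.logb_pow, Real.logb_pow]
        ring
    _ ≤ ∑ y : Fin P × Fin Q,
          (G (S.ζ (x + y.1 * L - a) (S.φ (t + y.2 * n * τ) f)) + overhead q n cost) := by
        gcongr with y
        exact hcost f y
    _ = _ := by simp only [Fintype.sum_prod_type, Finset.sum_range]

end

end ExtendedSystem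

theorem sum_range_mul (F : ℕ → ℝ) (L P : ℕ) :
    ∑ m ∈ Finset.range (L * P), F m =
      ∑ o ∈ Finset.range L, ∑ p ∈ Finset.range P, F (o + p * L) := by
  rw [Finset.sum_comm]
  induction P with
  | zero => simp
  | succ P ih =>
    rw [Nat.mul_succ, Finset.sum_range_add, ih, Finset.sum_range_succ]
    simp only [mul_comm P, add_comm (L * P)]

theorem sum_le_sum_subrectangle {h : ℕ → ℕ → ℝ} {B : ℝ} (hB : ∀ m k, h m k ≤ B) {u v R N H : ℕ}
    (hu : H + R ≤ u) (hv : H + N ≤ v) :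
    ∑ m ∈ Finset.range u, ∑ k ∈ Finset.range v, h m k ≤
      ∑ m ∈ Finset.range R, ∑ k ∈ Finset.range N, h (H + m) (H + k) + (u * v - R * N) * B := by
  have hsub : Finset.Ico H (H + R) ×ˢ Finset.Ico H (H + N) ⊆
      Finset.range u ×ˢ Finset.range v := by
    intro x hx
    simp only [Finset.mem_product, Finset.mem_Ico, Finset.mem_range] at hx ⊢
    omega
  have hle := Finset.sum_le_sum_of_subset_of_nonneg (f := fun x : ℕ × ℕ => B - h x.1 x.2) hsub
    fun x _ _ => sub_nonneg.2 (hB x.1 x.2)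
  simp only [Finset.sum_sub_distrib, Finset.sum_product, Finset.sum_Ico_eq_sum_range,
    add_tsub_cancel_left, Finset.sum_const, Finset.card_product, Finset.card_range, Nat.card_Ico,
    nsmul_eq_mul] at hle
  push_cast at hle
  linarith

namespace ExtendedSystem

variable {S : ExtendedSystem}

section

variable {q L n : ℕ} {τ ε a : ℝ} {Ω : Type*} [Fintype Ω] {s : Ω → Fin n → S.Ball ε}
  {cost : Ω → ℝ} {G : S.State → ℝ}

-- Average of `card_mul_logb_le_sum_array` over the `L n` positions of the array modulo the tiles.
theorem CodesWithin.mul_card_mul_logb_le_sum_box (hG : CodesWithin τ a (a + L) s cost G)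
    (hq : S.GluesWith q) (hL : 0 < L) {P : ℕ} (hP : 1 < P) (Q : ℕ) (X T : ℝ) (E : Finset S.State)
    (hE : ∀ f ∈ E, ∀ g ∈ E, (∀ k, n ≤ k → k < Q * n → S.wdist (X + L) (X + P * L)
      (S.φ (T + k * τ) f) (S.φ (T + k * τ) g) < 2 * ε) → f = g) :
    L * n * (E.card * Real.logb 2 E.card) ≤
      ∑ f ∈ E, ∑ m ∈ Finset.range (L * P), ∑ k ∈ Finset.range (n * Q),
        (G (S.ζ (X + m - a) (S.φ (T + k * τ) f)) + overhead q n cost) := by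
  have hL' : (0 : ℝ) < L := mod_cast hL
  have hP' : (1 : ℝ) < P := mod_cast hP
  have harray : ∀ o ∈ Finset.range L, ∀ o' ∈ Finset.range n,
      E.card * Real.logb 2 E.card ≤ ∑ f ∈ E, ∑ p ∈ Finset.range P, ∑ i ∈ Finset.range Q,
        (G (S.ζ (X + (o + p * L : ℕ) - a) (S.φ (T + (o' + i * n : ℕ) * τ) f)) +
          overhead q n cost) := by
    intro o ho o' ho'
    rw [Finset.mem_range] at ho ho'
    have hoL : (o : ℝ) ≤ L := mod_cast ho.le
    refine (hG.card_mul_logb_le_sum_array hq hL (zero_lt_one.trans hP) Q (X + o) (T + o' * τ) E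
      fun f hf g hg h => hE f hf g hg fun k hnk hk => ?_).trans_eq ?_
    · have htime : T + o' * τ + ((k - o' : ℕ) : ℝ) * τ = T + k * τ := by
        rw [Nat.cast_sub (by omega)]
        ring
      have hclose := h (k - o') (by omega)
      rw [htime] at hclose
      exact (wdist_mono (by linarith) (by nlinarith) (by linarith [o.cast_nonneg (α := ℝ)])
        _ _).trans_lt hclose
    · exact Finset.sum_congr rfl fun f _ => Finset.sum_congr rfl fun p _ =>
        Finset.sum_congr rfl fun i _ => by push_cast; ring_nf
  calc L * n * (E.card * Real.logb 2 E.card)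
      = ∑ _o ∈ Finset.range L, ∑ _o' ∈ Finset.range n, E.card * Real.logb 2 E.card := by
        simp only [Finset.sum_const, Finset.card_range, nsmul_eq_mul]
        ring
    _ ≤ _ := Finset.sum_le_sum fun o ho => Finset.sum_le_sum (harray o ho)
    _ = _ := by
      simp only [sum_range_mul]
      rw [Finset.sum_comm (s := E)]
      refine Finset.sum_congr rfl fun o _ => ?_
      rw [Finset.sum_comm (t := E)]
      exact Finset.sum_congr rfl fun f _ => Finset.sum_comm

end

variable (S) in
/-- The mean over a finite set of initial states and a rectangle of space and time shifts. -/
def latticeMean (τ : ℝ) (E : Finset S.State) (A : ℝ) (R N : ℕ) (F : S.State → ℝ) : ℝ :=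
  𝔼 x ∈ E ×ˢ (Finset.range R ×ˢ Finset.range N), F (S.ζ (A + x.2.1) (S.φ (x.2.2 * τ) x.1))

variable (S) in
/-- `E` is a finite set of pairwise distinguishable orbits which realizes the entropy `c` per unit
time and volume: there are at least `2 ^ (c |Λ| T)` of them over a window `Λ` of length `R` during
the time `T = N τ`. -/
structure RealizesEntropy (c τ ε A : ℝ) (R N : ℕ) (E : Finset S.State) : Prop where
  nonempty : E.Nonempty
  pairwise : (E : Set S.State).Pairwise fun f g => ¬ S.Indistinguishable A (A + R) (N * τ) ε f g
  le_logb : c * (R * N * τ) ≤ Real.logb 2 E.card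

section

variable {τ ε η δ A : ℝ} {R N : ℕ} {E : Finset S.State}

theorem isMean_latticeMean (hE : E.Nonempty) (hR : 0 < R) (hN : 0 < N) :
    IsMean (S.latticeMean τ E A R N) :=
  (isMean_expect (hE.product ((Finset.nonempty_range_iff.2 hR.ne').product
    (Finset.nonempty_range_iff.2 hN.ne')))).map
      fun x => S.ζ (A + x.2.1) (S.φ (x.2.2 * τ) x.1)

theorem StaysClose.indistinguishable (hclose : S.StaysClose τ η δ ε) (hτ : 0 < τ) (hδ : 0 ≤ δ)
    {B A' B' T D : ℝ} {n M : ℕ} (hAB : A < B) (hA : A' ≤ A - δ) (hB : B + δ ≤ B')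
    (hT : T + n * τ ≤ 0) (hD : D ≤ T + M * τ) {f g : S.State}
    (h : ∀ k, n ≤ k → k < M → S.wdist A' B' (S.φ (T + k * τ) f) (S.φ (T + k * τ) g) < η) :
    S.Indistinguishable A B D ε f g := by
  rintro t ⟨ht0, htD⟩
  have hnτ : (0 : ℝ) ≤ n * τ := by positivity
  have htT : 0 ≤ (t - T) / τ := div_nonneg (by linarith) hτ.le
  set k := ⌊(t - T) / τ⌋₊
  have hle : k * τ ≤ t - T := (le_div_iff₀ hτ).1 (Nat.floor_le htT)
  have hge : t - T ≤ (k + 1) * τ := (div_le_iff₀ hτ).1 (Nat.lt_floor_add_one _).le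
  have hnk : n ≤ k := Nat.le_floor ((le_div_iff₀ hτ).2 (by linarith))
  have hkM : k < M := (Nat.floor_lt htT).2 ((div_lt_iff₀ hτ).2 (by linarith))
  have hlt := hclose A B hAB (t - T - k * τ) (by linarith) (by linarith) _ _
    ((wdist_mono hA (by linarith) hB _ _).trans_lt (h k hnk hkM))
  rwa [← φ_add, ← φ_add, show t - T - k * τ + (T + k * τ) = t by ring] at hlt

theorem sum_box_le_latticeMean (hE : E.Nonempty) (hR : 0 < R) (hN : 0 < N) {F : S.State → ℝ}
    {D : ℝ} (hF : ∀ f, F f ≤ D) (y t : ℝ) {u v H : ℕ} (hu : H + R ≤ u) (hv : H + N ≤ v) :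
    ∑ f ∈ E, ∑ m ∈ Finset.range u, ∑ k ∈ Finset.range v,
        F (S.ζ (y + A - H + m) (S.φ (t - H * τ + k * τ) f)) ≤
      E.card * (R * N * S.latticeMean τ E A R N (fun f => F (S.ζ y (S.φ t f))) +
        (u * v - R * N) * D) := by
  have hmean : ∑ f ∈ E, ∑ m ∈ Finset.range R, ∑ k ∈ Finset.range N,
        F (S.ζ y (S.φ t (S.ζ (A + m) (S.φ (k * τ) f)))) =
      E.card * (R * N * S.latticeMean τ E A R N fun f => F (S.ζ y (S.φ t f))) := by
    have : (0 : ℝ) < E.card := mod_cast hE.card_pos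
    have : (0 : ℝ) < R := mod_cast hR
    have : (0 : ℝ) < N := mod_cast hN
    simp only [latticeMean, Finset.expect_eq_sum_div_card, Finset.sum_product,
      Finset.card_product, Finset.card_range]
    push_cast
    rw [← mul_assoc, mul_div_cancel₀ _ (by positivity)]
  rw [mul_add, ← hmean, ← nsmul_eq_mul E.card, ← Finset.sum_const, ← Finset.sum_add_distrib]
  refine Finset.sum_le_sum fun f _ => (sum_le_sum_subrectangle (R := R) (N := N)
    (h := fun m k => F (S.ζ (y + A - H + m) (S.φ (t - H * τ + k * τ) f)))
    (fun m k => hF _) hu hv).trans_eq ?_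
  congr 1
  refine Finset.sum_congr rfl fun m _ => Finset.sum_congr rfl fun k _ => ?_
  rw [φ_ζ, ← φ_add, ← ζ_add]
  push_cast
  ring_nf

end

end ExtendedSystem

theorem exists_le_mul_le_add {L : ℕ} (hL : 0 < L) (m : ℕ) :
    ∃ P : ℕ, m ≤ L * P ∧ L * P ≤ m + L :=
  ⟨m / L + 1, (Nat.lt_mul_div_succ m hL).le, by
    rw [mul_add, mul_one]
    exact Nat.add_le_add_right (Nat.mul_div_le m L) L⟩

namespace ExtendedSystem

variable {S : ExtendedSystem}

section

variable {q L n R N : ℕ} {τ ε ε' δ a c A : ℝ} {E : Finset S.State} {Ω : Type*} [Fintype Ω]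
  {s : Ω → Fin n → S.Ball ε} {cost : Ω → ℝ} {G : S.State → ℝ}

theorem RealizesEntropy.le_sum_box (hE : S.RealizesEntropy c τ ε' A R N E)
    (hG : CodesWithin τ a (a + L) s cost G) (hq : S.GluesWith q) (hτ : 0 < τ) (hδ : 0 ≤ δ)
    (hclose : S.StaysClose τ (2 * ε) δ ε') (hL : 0 < L) (hR : 0 < R) {P Q : ℕ} (hP : 1 < P)
    {X T : ℝ} (hX : X + L ≤ A - δ) (hX' : A + R + δ ≤ X + P * L) (hT : T + n * τ ≤ 0)
    (hT' : N * τ ≤ T + (Q * n : ℕ) * τ) :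
    E.card * (L * n * (c * (R * N * τ))) ≤
      ∑ f ∈ E, ∑ m ∈ Finset.range (L * P), ∑ k ∈ Finset.range (n * Q),
        (G (S.ζ (X + m - a) (S.φ (T + k * τ) f)) + overhead q n cost) := by
  have hbox := hG.mul_card_mul_logb_le_sum_box hq hL hP Q X T E fun f hf g hg h =>
    hE.pairwise.eq hf hg <| not_not_intro <|
      hclose.indistinguishable hτ hδ (lt_add_of_pos_right A (mod_cast hR)) hX hX' hT hT' h
  calc E.card * (L * n * (c * (R * N * τ))) ≤ E.card * (L * n * Real.logb 2 E.card) := by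
        gcongr
        exact hE.le_logb
    _ = L * n * (E.card * Real.logb 2 E.card) := by ring
    _ ≤ _ := hbox

theorem latticeMean_add_const (hE : E.Nonempty) (hR : 0 < R) (hN : 0 < N) (F : S.State → ℝ)
    (κ : ℝ) : S.latticeMean τ E A R N (fun f => F f + κ) = S.latticeMean τ E A R N F + κ := by
  rw [latticeMean, Finset.expect_add_distrib, Finset.expect_const, latticeMean]
  exact hE.product ((Finset.nonempty_range_iff.2 hR.ne').product
    (Finset.nonempty_range_iff.2 hN.ne'))

theorem RealizesEntropy.le_latticeMean (hE : S.RealizesEntropy c τ ε' A R N E)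
    (hG : CodesWithin τ a (a + L) s cost G) (hq : S.GluesWith q) (hτ : 0 < τ) (hδ : 0 ≤ δ)
    (hclose : S.StaysClose τ (2 * ε) δ ε') (hL : 0 < L) (hR : 0 < R) (hN : 0 < N) {D : ℝ}
    (hD : ∀ f, G f + overhead q n cost ≤ D) {y t : ℝ} {H P Q : ℕ}
    (hHx : |a| + |y| + δ + L ≤ H) (hHt : n * τ + |t| ≤ H * τ) (hP : R + 2 * H ≤ L * P)
    (hQ : N + 2 * H ≤ n * Q) :
    L * n * (c * (R * N * τ)) ≤
      R * N * (S.latticeMean τ E A R N (fun f => G (S.ζ y (S.φ t f))) + overhead q n cost) +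
        ((L * P : ℕ) * (n * Q : ℕ) - R * N) * D := by
  have hLH : L ≤ H := by
    rify
    linarith [abs_nonneg a, abs_nonneg y]
  have hX : a + y + A - H + L ≤ A - δ := by linarith [le_abs_self a, le_abs_self y]
  have hX' : A + R + δ ≤ a + y + A - H + P * L := by
    have : (R : ℝ) + 2 * H ≤ L * P := mod_cast hP
    linarith [neg_abs_le a, neg_abs_le y, L.cast_nonneg (α := ℝ)]
  have hT' : N * τ ≤ t - H * τ + (Q * n : ℕ) * τ := by
    have : ((N : ℝ) + 2 * H) * τ ≤ (Q * n : ℕ) * τ := by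
      gcongr
      rw [mul_comm Q]
      exact_mod_cast hQ
    have : 0 ≤ n * τ := by positivity
    linarith [neg_abs_le t]
  have hbox := hE.le_sum_box hG hq hτ hδ hclose hL hR (lt_of_mul_lt_mul_left (by omega) L.zero_le)
    hX hX' (by linarith [le_abs_self t]) hT'
  have hmean := sum_box_le_latticeMean (A := A) (τ := τ) hE.nonempty hR hN hD y t
    (u := L * P) (v := n * Q) (H := H) (by omega) (by omega)
  rw [latticeMean_add_const hE.nonempty hR hN] at hmean
  refine le_of_mul_le_mul_left (hbox.trans (le_of_eq_of_le ?_ hmean))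
    (mod_cast hE.nonempty.card_pos)
  simp only [show ∀ m : ℕ, a + y + A - H + m - a = y + A - H + m by intro m; ring]

-- The array of tiles used to code `E` extends the window and the time interval over which `E` is
-- distinguishable by at most `H`, which is negligible for large `R` and `N`.
theorem CodesWithin.exists_le_latticeMean (hG : CodesWithin τ a (a + L) s cost G)
    (hq : S.GluesWith q) (hτ : 0 < τ) (hδ : 0 ≤ δ) (hclose : S.StaysClose τ (2 * ε) δ ε')
    (hL : 0 < L) (hn : 0 < n) {D : ℝ} (hD0 : 0 ≤ D) (hD : ∀ f, G f + overhead q n cost ≤ D)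
    (c y t : ℝ) :
    ∃ H : ℕ, ∀ (E : Finset S.State) (A : ℝ) (R N : ℕ), 0 < R → 0 < N →
      S.RealizesEntropy c τ ε' A R N E →
        c * τ * L * n - overhead q n cost - ((1 + H / R) * (1 + H / N) - 1) * D ≤
          S.latticeMean τ E A R N fun f => G (S.ζ y (S.φ t f)) := by
  obtain ⟨H, hH⟩ := exists_nat_ge (max (|a| + |y| + δ + L) (n + |t| / τ))
  obtain ⟨hHx, hHt⟩ := max_le_iff.1 hH
  replace hHt : n * τ + |t| ≤ H * τ :=
    calc n * τ + |t| = (n + |t| / τ) * τ := by field_simp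
      _ ≤ H * τ := by gcongr
  set H' := 2 * H + L + n
  refine ⟨H', fun E A R N hR hN hE => ?_⟩
  obtain ⟨P, hP, hP'⟩ := exists_le_mul_le_add hL (R + 2 * H)
  obtain ⟨Q, hQ, hQ'⟩ := exists_le_mul_le_add hn (N + 2 * H)
  have hmean := hE.le_latticeMean hG hq hτ hδ hclose hL hR hN hD hHx hHt hP hQ
  have hR' : (0 : ℝ) < R := mod_cast hR
  have hN' : (0 : ℝ) < N := mod_cast hN
  have harea : ((L * P : ℕ) : ℝ) * (n * Q : ℕ) ≤ (R + H') * (N + H') := by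
    gcongr <;> norm_cast <;> omega
  refine le_of_mul_le_mul_left ?_ (mul_pos hR' hN')
  calc R * N * (c * τ * L * n - overhead q n cost - ((1 + H' / R) * (1 + H' / N) - 1) * D)
      = L * n * (c * (R * N * τ)) - R * N * overhead q n cost -
        ((R + H') * (N + H') - R * N) * D := by field_simp
    _ ≤ R * N * S.latticeMean τ E A R N (fun f => G (S.ζ y (S.φ t f))) := by
      linarith [mul_le_mul_of_nonneg_right harea hD0]

end

end ExtendedSystem

theorem eventually_natCeil_le_mul {θ : ℝ} (hθ : 1 < θ) :
    ∀ᶠ x : ℝ in atTop, (⌈x⌉₊ : ℝ) ≤ θ * x := by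
  filter_upwards [(tendsto_nat_ceil_div_atTop (R := ℝ)).eventually_le_const hθ,
    eventually_gt_atTop 0] with x hx hx0
  exact (div_le_iff₀ hx0).1 hx

theorem exists_natCast_le_of_lt_log₂card {x : ℝ} (hx : 0 ≤ x) {N : ℕ∞}
    (h : ENNReal.ofReal x < log₂card N) :
    ∃ k : ℕ, 0 < k ∧ (k : ℕ∞) ≤ N ∧ x ≤ Real.logb 2 k := by
  have hpow : (0 : ℝ) < 2 ^ x := Real.rpow_pos_of_pos two_pos x
  have hceil : 0 < ⌈(2 : ℝ) ^ x⌉₊ := Nat.ceil_pos.2 hpow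
  refine ⟨⌈(2 : ℝ) ^ x⌉₊, hceil, ?_,
    (Real.le_logb_iff_rpow_le one_lt_two (mod_cast hceil)).2 (Nat.le_ceil _)⟩
  by_cases htop : N = ⊤
  · exact htop ▸ le_top
  · rw [log₂card, if_neg htop, ENNReal.ofReal_lt_ofReal_iff_of_nonneg hx] at h
    have hN : (0 : ℝ) < N.toNat := by
      refine Nat.cast_pos.2 (Nat.pos_of_ne_zero fun h0 => (hx.trans_lt h).ne' ?_)
      rw [h0, Nat.cast_zero, Real.logb_zero]
    rw [← ENat.natCast_toNat htop]
    exact mod_cast Nat.ceil_le.2 ((Real.lt_logb_iff_rpow_lt one_lt_two hN).1 h).le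

namespace ExtendedSystem

variable {S : ExtendedSystem}

theorem exists_finset_card_eq_of_le_maxOrbits {a b T ε : ℝ} {k : ℕ}
    (hk : (k : ℕ∞) ≤ S.maxOrbits a b T ε) :
    ∃ E : Finset S.State, E.card = k ∧
      (E : Set S.State).Pairwise fun f g => ¬ S.Indistinguishable a b T ε f g := by
  rcases k with - | k
  · exact ⟨∅, rfl, by simp⟩
  · obtain ⟨D, hD⟩ := lt_iSup_iff.1 ((Nat.cast_lt.2 k.lt_succ_self).trans_le hk)
    obtain ⟨hpairwise, hcard⟩ := lt_iSup_iff.1 hD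
    obtain ⟨D', hsub, hD'⟩ := Set.exists_subset_encard_eq (k := ((k + 1 : ℕ) : ℕ∞)) <| by
      simpa using Order.add_one_le_of_lt hcard
    have hfin : D'.Finite := Set.finite_of_encard_eq_coe hD'
    refine ⟨hfin.toFinset, ?_, by simpa using hpairwise.mono hsub⟩
    rwa [hfin.encard_eq_coe_toFinset_card, Nat.cast_inj] at hD'

theorem exists_realizesEntropy {a b T τ ε c θ : ℝ} (hab : a < b) (hT : 0 < T) (hτ : 0 < τ)
    (hc : 0 ≤ c) (hb : ⌈b - a⌉₊ ≤ θ * (b - a)) (hT' : ⌈T / τ⌉₊ ≤ θ * (T / τ))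
    (h : ENNReal.ofReal (c * (θ * (b - a)) * (θ * T)) < log₂card (S.maxOrbits a b T ε)) :
    ∃ E, S.RealizesEntropy c τ ε a ⌈b - a⌉₊ ⌈T / τ⌉₊ E := by
  have hb0 : 0 ≤ θ * (b - a) := (Nat.cast_nonneg _).trans hb
  have hT0 : ⌈T / τ⌉₊ * τ ≤ θ * T :=
    calc ⌈T / τ⌉₊ * τ ≤ θ * (T / τ) * τ := by gcongr
      _ = θ * T := by field_simp
  obtain ⟨k, hk, hkN, hlog⟩ := exists_natCast_le_of_lt_log₂card
    (mul_nonneg (mul_nonneg hc hb0) ((by positivity : 0 ≤ ⌈T / τ⌉₊ * τ).trans hT0)) h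
  obtain ⟨E, rfl, hE⟩ := exists_finset_card_eq_of_le_maxOrbits hkN
  refine ⟨E, Finset.card_pos.1 hk, hE.imp fun f g hfg hfg' => hfg fun t ht => ?_, ?_⟩
  · exact (wdist_mono le_rfl hab (sub_le_iff_le_add'.1 (Nat.le_ceil _)) _ _).trans_lt
      (hfg' t ⟨ht.1, ht.2.trans_le ((div_le_iff₀ hτ).1 (Nat.le_ceil _))⟩)
  · calc c * (⌈b - a⌉₊ * ⌈T / τ⌉₊ * τ) = c * ⌈b - a⌉₊ * (⌈T / τ⌉₊ * τ) := by ring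
      _ ≤ c * (θ * (b - a)) * (θ * T) := by gcongr
      _ ≤ Real.logb 2 E.card := hlog

theorem exists_realizesEntropy_of_lt_upperTopEntropy {τ c : ℝ} (hτ : 0 < τ) (hc : 0 < c)
    (h : ENNReal.ofReal c < S.upperTopEntropy) :
    ∃ ε : ℝ, 0 < ε ∧ ∀ j : ℕ, ∃ (E : Finset S.State) (A : ℝ) (R N : ℕ),
      j < R ∧ j < N ∧ S.RealizesEntropy c τ ε A R N E := by
  obtain ⟨c', -, hcc', hc'⟩ := ENNReal.lt_iff_exists_real_btwn.1 h
  rw [ENNReal.ofReal_lt_ofReal_iff_of_nonneg hc.le] at hcc'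
  obtain ⟨ε, hc'⟩ := lt_iSup_iff.1 hc'
  obtain ⟨hε, hc'⟩ := lt_iSup_iff.1 hc'
  have hc'0 : 0 < c' := hc.trans hcc'
  refine ⟨ε, hε, fun j => ?_⟩
  -- Rounding `b - a` and `T / τ` up to integers loses less than `θ ^ 2 = c' / c` in the entropy.
  set θ := √(c' / c)
  have hθ : 1 < θ := Real.lt_sqrt_of_sq_lt (by rwa [one_pow, one_lt_div hc])
  have hθc : c * θ * θ = c' := by
    rw [mul_assoc, Real.mul_self_sqrt (by positivity), mul_div_cancel₀ _ hc.ne']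
  have hlength : Tendsto (fun Λ : ℝ × ℝ => Λ.2 - Λ.1) windowsToInfinity atTop := tendsto_comap
  obtain ⟨⟨a, b⟩, ⟨⟨hΛ, hbj⟩, hab⟩, hb⟩ :=
    ((((frequently_lt_of_lt_limsup (by isBoundedDefault) hc').and_eventually
      (hlength.eventually_gt_atTop (j : ℝ))).and_eventually
      (hlength.eventually_gt_atTop 0)).and_eventually
      (hlength.eventually (eventually_natCeil_le_mul hθ))).exists
  simp only at hΛ hbj hab hb
  rw [ENNReal.lt_div_iff_mul_lt (Or.inl (by simpa using hab)) (Or.inl ENNReal.ofReal_ne_top),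
    ← ENNReal.ofReal_mul hc'0.le] at hΛ
  have hτT : Tendsto (· / τ) atTop atTop := tendsto_id.atTop_div_const hτ
  obtain ⟨T, ⟨⟨hT, hTj⟩, hT0⟩, hT'⟩ :=
    ((((frequently_lt_of_lt_limsup (by isBoundedDefault) hΛ).and_eventually
      (hτT.eventually_gt_atTop (j : ℝ))).and_eventually
      (eventually_gt_atTop 0)).and_eventually
      (hτT.eventually (eventually_natCeil_le_mul hθ))).exists
  rw [ENNReal.lt_div_iff_mul_lt (Or.inl (by simpa using hT0)) (Or.inl ENNReal.ofReal_ne_top),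
    ← ENNReal.ofReal_mul (mul_pos hc'0 hab).le, ← hθc,
    show c * θ * θ * (b - a) * T = c * (θ * (b - a)) * (θ * T) by ring] at hT
  obtain ⟨E, hE⟩ := exists_realizesEntropy (sub_pos.1 hab) hT0 hτ hc.le hb hT' hT
  exact ⟨E, a, _, _, Nat.lt_ceil.2 hbj, Nat.lt_ceil.2 hTj, hE⟩

end ExtendedSystem

namespace ComplexityFunction

variable {K : ComplexityFunction}

theorem Counting.sum_floor_eq_le (hK : K.Counting) (r n k : ℕ) :
    ∑ ω : Fin n → Fin r with ⌊(K r (List.ofFn ω) : ℝ)⌋₊ = k,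
      (2 : ℝ) ^ (-(K r (List.ofFn ω) : ℝ)) ≤ 2 := by
  set Ω : Finset (Fin n → Fin r) := {ω | ⌊(K r (List.ofFn ω) : ℝ)⌋₊ = k}
  have hfloor (ω) (hω : ω ∈ Ω) : ⌊(K r (List.ofFn ω) : ℝ)⌋₊ = k := (Finset.mem_filter.1 hω).2
  have hcard : (Ω.card : ℝ) ≤ 2 ^ ((k : ℝ) + 1) := by
    obtain ⟨hfin, hle⟩ := hK r ((k : ℝ) + 1)
    rw [Set.ncard_eq_toFinset_card _ hfin] at hle
    refine le_trans (Nat.cast_le.2 <| Finset.card_le_card_of_injOn List.ofFn (fun ω hω => ?_)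
      List.ofFn_injective.injOn) hle
    rw [Set.Finite.coe_toFinset, mem_ofPred_eq, ← hfloor ω hω]
    exact Nat.lt_floor_add_one _
  have hterm (ω) (hω : ω ∈ Ω) : (2 : ℝ) ^ (-(K r (List.ofFn ω) : ℝ)) ≤ 2 ^ (-(k : ℝ)) := by
    refine Real.rpow_le_rpow_of_exponent_le one_lt_two.le (neg_le_neg ?_)
    rw [← hfloor ω hω]
    exact Nat.floor_le (NNReal.coe_nonneg _)
  calc ∑ ω ∈ Ω, (2 : ℝ) ^ (-(K r (List.ofFn ω) : ℝ)) ≤ Ω.card * 2 ^ (-(k : ℝ)) := by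
        rw [← nsmul_eq_mul]
        exact Finset.sum_le_card_nsmul _ _ _ hterm
    _ ≤ 2 ^ ((k : ℝ) + 1) * 2 ^ (-(k : ℝ)) := by gcongr
    _ = 2 := by
      rw [← Real.rpow_add two_pos, add_neg_cancel_comm, Real.rpow_one]

theorem exists_kraftSum_le (hH3 : K.Shannon) (hH4 : K.Counting) (r : ℕ) :
    ∃ D : ℝ, 0 < D ∧ ∀ n : ℕ,
      kraftSum (fun ω : Fin n → Fin r => (K r (List.ofFn ω) : ℝ)) ≤ D * (n + 1) := by
  obtain ⟨B, hB⟩ := hH3.exists_linear_bound r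
  refine ⟨2 * (B + 1), by positivity, fun n => ?_⟩
  have hlevel (ω : Fin n → Fin r) (_ : ω ∈ Finset.univ) :
      ⌊(K r (List.ofFn ω) : ℝ)⌋₊ ∈ Finset.range (⌊(B : ℝ) * (n + 1)⌋₊ + 1) := by
    rw [Finset.mem_range, Nat.lt_succ_iff]
    exact Nat.floor_le_floor (by simpa using hB (List.ofFn ω))
  rw [kraftSum, ← Finset.sum_fiberwise_of_maps_to hlevel]
  calc _ ≤ (⌊(B : ℝ) * (n + 1)⌋₊ + 1) * (2 : ℝ) := by
        refine (Finset.sum_le_card_nsmul _ _ _ fun k _ => hH4.sum_floor_eq_le r n k).trans_eq ?_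
        rw [Finset.card_range, nsmul_eq_mul, Nat.cast_add_one]
    _ ≤ (B * (n + 1) + (n + 1)) * 2 := by
        gcongr
        · exact Nat.floor_le (by positivity)
        · exact le_add_of_nonneg_left n.cast_nonneg
    _ = 2 * (B + 1) * (n + 1) := by ring

end ComplexityFunction

namespace ExtendedSystem

variable {S : ExtendedSystem}

/-- The group of space-time translations `ζ_y φ_t`, with `(y, t) : ℝ × ℝ`, acting on states. -/
instance : AddAction (ℝ × ℝ) S.State where
  vadd a f := S.ζ a.1 (S.φ a.2 f)
  zero_vadd f := (ζ_zero _).trans (φ_zero f)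
  add_vadd a b f := by
    change S.ζ (a.1 + b.1) (S.φ (a.2 + b.2) f) = S.ζ a.1 (S.φ a.2 (S.ζ b.1 (S.φ b.2 f)))
    rw [ζ_add, φ_add, φ_ζ]

theorem vadd_eq (a : ℝ × ℝ) (f : S.State) : a +ᵥ f = S.ζ a.1 (S.φ a.2 f) := rfl

theorem SeparationBound.continuousConstVAdd (hA3 : S.SeparationBound) (hA1 : S.WindowsCompact) :
    ContinuousConstVAdd (ℝ × ℝ) S.State :=
  ⟨fun a => (continuous_ζ a.1).comp (hA3.continuous_φ hA1 a.2)⟩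

theorem isInvariant_of_measurePreserving_vadd {μ : Measure S.State}
    (hμ : ∀ a : ℝ × ℝ, MeasurePreserving (a +ᵥ ·) μ μ) : S.IsInvariant μ where
  shift y := by simpa only [vadd_eq, φ_zero] using hμ (y, 0)
  flow t := by simpa only [vadd_eq, ζ_zero] using hμ (0, t)

variable (S) in
/-- On average over `μ`, coding a tile of length `L` during `n` time steps by balls of radius less
than `ε` costs at least `h L n`, up to the overhead of the code. -/
def CostBound (q : ℕ) (μ : Measure S.State) (τ ε h : ℝ) : Prop :=
  ∀ (a : ℝ) (L n : ℕ) (Ω : Type) [Fintype Ω] (s : Ω → Fin n → S.Ball ε) (cost : Ω → ℝ)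
    (G : S.State → ℝ), 0 < L → 0 < n → Continuous G → CodesWithin τ a (a + L) s cost G →
      h * L * n - overhead q n cost ≤ ∫ f, G f ∂μ

theorem tendsto_one_add_div_sq_sub_one_mul (H D : ℝ) :
    Tendsto (fun j : ℕ => ((1 + H / (j + 1)) * (1 + H / (j + 1)) - 1) * D) atTop (𝓝 0) := by
  have h : Tendsto (fun j : ℕ => 1 + H / ((j : ℝ) + 1)) atTop (𝓝 (1 + 0)) :=
    (tendsto_const_nhds.div_atTop
      (tendsto_atTop_add_const_right _ _ tendsto_natCast_atTop_atTop)).const_add 1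
  simpa using ((h.mul h).sub_const 1).mul_const D

theorem exists_invariant_measure_costBound (hA1 : S.WindowsCompact) (hA3 : S.SeparationBound)
    {q : ℕ} (hq : S.GluesWith q) {τ c : ℝ} (hτ : 0 < τ) (hc : 0 < c)
    (h : ENNReal.ofReal c < S.upperTopEntropy) :
    ∃ (ε : ℝ) (μ : Measure S.State), 0 < ε ∧ IsProbabilityMeasure μ ∧ S.IsInvariant μ ∧
      S.CostBound q μ τ ε (c * τ) := by
  have := hA1.compactSpace
  have := hA3.continuousConstVAdd hA1
  obtain ⟨ε', hε', hE⟩ := exists_realizesEntropy_of_lt_upperTopEntropy hτ hc h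
  choose E A R N hR hN hE using hE
  obtain ⟨η, δ, hη, hδ, hclose⟩ := hA3.exists_staysClose τ hε'
  have hR0 (j) : 0 < R j := j.zero_le.trans_lt (hR j)
  have hN0 (j) : 0 < N j := j.zero_le.trans_lt (hN j)
  obtain ⟨μ, hμ, hinv, hint⟩ := exists_invariant_measure (A := ℝ × ℝ) fun j =>
    isMean_latticeMean (τ := τ) (A := A j) (hE j).nonempty (hR0 j) (hN0 j)
  refine ⟨η / 2, μ, half_pos hη, hμ, isInvariant_of_measurePreserving_vadd hinv, ?_⟩
  intro a L n Ω _ s cost G hL hn hG hcodes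
  refine hint G _ hG fun y κ hκ => ?_
  obtain ⟨B, hB⟩ := bddFun_of_continuous hG
  set D := max 0 (B + overhead q n cost)
  have hD0 : 0 ≤ D := le_max_left _ _
  have hD (f) : G f + overhead q n cost ≤ D :=
    (by gcongr; exact (le_abs_self _).trans (hB f) : _ ≤ B + _).trans (le_max_right _ _)
  obtain ⟨H, hH⟩ := hcodes.exists_le_latticeMean hq hτ hδ (by rwa [mul_div_cancel₀ _ two_ne_zero])
    hL hn hD0 hD c y.1 y.2
  filter_upwards [(tendsto_one_add_div_sq_sub_one_mul H D).eventually_lt_const hκ] with j hj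
  refine le_trans ?_ (hH (E j) (A j) (R j) (N j) (hR0 j) (hN0 j) (hE j))
  have hboundary : ((1 + H / R j) * (1 + H / N j) - 1) * D ≤
      ((1 + H / (j + 1)) * (1 + H / (j + 1)) - 1) * D := by
    gcongr <;> norm_cast
    · exact hR j
    · exact hN j
  linarith

variable {K : ComplexityFunction}

/-! ### Coding with a finite family of coverings -/

section

variable {a b ε τ : ℝ} {n : ℕ}

theorem Covering.exists_codes (U : S.Covering a b ε) (τ : ℝ) (f : S.State) (n : ℕ) :
    ∃ ω, U.Codes τ f n ω := by
  choose ω hω using U.covers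
  exact ⟨fun j => ω (S.φ (j * τ) f), fun j => hω _⟩

theorem Covering.orbitComplexity_le_of_codes {U : S.Covering a b ε} {f : S.State}
    {ω : Fin n → Fin U.card} (hω : U.Codes τ f n ω) :
    U.orbitComplexity K τ f n ≤ K U.card (List.ofFn ω) :=
  iInf₂_le ω hω

/-- How far the orbit of `f` is from being coded by `ω`: the sum of the relative excesses of the
distances to the centres over the radii. It is a continuous function of `f`. -/
def Covering.codingDefect (U : S.Covering a b ε) (τ : ℝ) (ω : Fin n → Fin U.card) (f : S.State) :
    ℝ :=
  ∑ j : Fin n, max 0 (S.wdist a b (S.φ (j * τ) f) (U.center (ω j)) / U.radius (ω j) - 1)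

/-- A ball of a covering, with its radius doubled so that orbits of coding defect less than one
still visit it. -/
def Covering.doubledBall (U : S.Covering a b (ε / 2)) (i : Fin U.card) : S.Ball ε where
  center := U.center i
  radius := 2 * U.radius i
  radius_pos := mul_pos two_pos (U.radius_pos i)
  radius_lt := by linarith [U.radius_lt i]

theorem Covering.codingDefect_nonneg (U : S.Covering a b ε) (τ : ℝ) (ω : Fin n → Fin U.card)
    (f : S.State) : 0 ≤ U.codingDefect τ ω f :=
  Finset.sum_nonneg fun _ _ => le_max_left _ _

theorem Covering.Codes.codingDefect_eq_zero {U : S.Covering a b ε} {f : S.State}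
    {ω : Fin n → Fin U.card} (hω : U.Codes τ f n ω) : U.codingDefect τ ω f = 0 :=
  Finset.sum_eq_zero fun j _ => max_eq_left <|
    sub_nonpos.2 <| (div_le_one (U.radius_pos _)).2 (hω j).le

theorem Covering.continuous_codingDefect (hA1 : S.WindowsCompact) (hA3 : S.SeparationBound)
    (hab : a < b) (U : S.Covering a b ε) (τ : ℝ) (ω : Fin n → Fin U.card) :
    Continuous (U.codingDefect τ ω) :=
  continuous_finsetSum _ fun _ _ => continuous_const.max <|
    (((continuous_wdist hab _).comp (hA3.continuous_φ hA1 _)).div_const _).sub continuous_const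

theorem Covering.follows_doubledBall {U : S.Covering a b (ε / 2)} {f : S.State}
    {ω : Fin n → Fin U.card} (hω : U.codingDefect τ ω f < 1) :
    Follows τ a b (fun j => U.doubledBall (ω j)) f := by
  intro j
  have hj : S.wdist a b (S.φ (j * τ) f) (U.center (ω j)) / U.radius (ω j) - 1 < 1 :=
    calc _ ≤ _ := le_max_right _ _
      _ ≤ U.codingDefect τ ω f :=
        Finset.single_le_sum (f := fun j : Fin n =>
          max 0 (S.wdist a b (S.φ (j * τ) f) (U.center (ω j)) / U.radius (ω j) - 1))
          (fun _ _ => le_max_left _ _) (Finset.mem_univ j)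
      _ < 1 := hω
  exact (div_lt_iff₀ (U.radius_pos _)).1 ((sub_lt_iff_lt_add.1 hj).trans_eq one_add_one_eq_two)

end

section

variable {ι : Type} {a b ε τ : ℝ} {n : ℕ}

/-- The words of length `n` over the alphabets of a family of coverings. -/
abbrev FamilyWord (V : ι → S.Covering a b ε) (n : ℕ) : Type := Σ i, Fin n → Fin (V i).card

/-- The complexity of a word as a cost, in the sense of `CodesWithin`. -/
def FamilyWord.cost {V : ι → S.Covering a b ε} (K : ComplexityFunction) (ω : FamilyWord V n) : ℝ :=
  K _ (List.ofFn ω.2)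

/-- The string of balls coded by a word, with their radii doubled. -/
def FamilyWord.balls {V : ι → S.Covering a b (ε / 2)} (ω : FamilyWord V n) (j : Fin n) :
    S.Ball ε :=
  (V ω.1).doubledBall (ω.2 j)

theorem nonempty_familyWord [Nonempty ι] (V : ι → S.Covering a b ε) (n : ℕ) :
    Nonempty (FamilyWord V n) := by
  obtain ⟨i⟩ := ‹Nonempty ι›
  obtain ⟨f⟩ : Nonempty S.State := S.nonempty.to_subtype
  exact ⟨⟨i, ((V i).exists_codes 0 f n).choose⟩⟩

variable [Fintype ι]

/-- A continuous substitute for the complexity of the orbit of `f`: the cost of a word increases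
with its coding defect, so fast that a word of defect at least one is never worth using. -/
def smoothCost (K : ComplexityFunction) (τ : ℝ) (V : ι → S.Covering a b ε) (n : ℕ)
    (f : S.State) : ℝ :=
  ⨅ ω : FamilyWord V n,
    (ω.cost K + (∑ ω' : FamilyWord V n, ω'.cost K) * (V ω.1).codingDefect τ ω.2 f)

theorem sum_cost_nonneg (K : ComplexityFunction) (V : ι → S.Covering a b ε) (n : ℕ) :
    0 ≤ ∑ ω : FamilyWord V n, ω.cost K :=
  Finset.sum_nonneg fun _ _ => NNReal.coe_nonneg _

theorem smoothCost_nonneg (V : ι → S.Covering a b ε) (f : S.State) :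
    0 ≤ smoothCost K τ V n f :=
  Real.iInf_nonneg fun _ => add_nonneg (NNReal.coe_nonneg _)
    (mul_nonneg (sum_cost_nonneg K V n) (Covering.codingDefect_nonneg _ _ _ _))

theorem ofReal_smoothCost_le (V : ι → S.Covering a b ε) (f : S.State) :
    ENNReal.ofReal (smoothCost K τ V n f) ≤ ⨅ i, (V i).orbitComplexity K τ f n := by
  refine le_iInf fun i => le_iInf₂ fun ω hω => ?_
  rw [← ENNReal.ofReal_coe_nnreal]
  refine ENNReal.ofReal_le_ofReal ?_
  refine (ciInf_le (Set.finite_range _).bddBelow (⟨i, ω⟩ : FamilyWord V n)).trans_eq ?_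
  rw [hω.codingDefect_eq_zero, mul_zero, add_zero]
  rfl

variable [Nonempty ι]

theorem continuous_smoothCost (hA1 : S.WindowsCompact) (hA3 : S.SeparationBound) (hab : a < b)
    (V : ι → S.Covering a b ε) (n : ℕ) : Continuous (smoothCost K τ V n) := by
  have := nonempty_familyWord V n
  have hinf : smoothCost K τ V n = fun f => Finset.univ.inf' Finset.univ_nonempty
      fun ω : FamilyWord V n =>
        ω.cost K + (∑ ω' : FamilyWord V n, ω'.cost K) * (V ω.1).codingDefect τ ω.2 f :=
    funext fun f => (Finset.inf'_univ_eq_ciInf _).symm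
  rw [hinf]
  exact Continuous.finset_inf'_apply _ fun ω _ => continuous_const.add <|
    continuous_const.mul <| (V ω.1).continuous_codingDefect hA1 hA3 hab τ ω.2

theorem codesWithin_smoothCost (K : ComplexityFunction) (τ : ℝ)
    (V : ι → S.Covering a b (ε / 2)) (n : ℕ) :
    CodesWithin τ a b (fun ω : FamilyWord V n => ω.balls) (fun ω => ω.cost K)
      (smoothCost K τ V n) := by
  have := nonempty_familyWord V n
  intro f
  obtain ⟨ω, hω⟩ := exists_eq_ciInf_of_finite (f := fun ω : FamilyWord V n =>
    ω.cost K + (∑ ω' : FamilyWord V n, ω'.cost K) * (V ω.1).codingDefect τ ω.2 f)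
  rw [smoothCost, ← hω]
  have hsum := sum_cost_nonneg K V n
  rcases lt_or_ge ((V ω.1).codingDefect τ ω.2 f) 1 with hlt | hge
  · exact ⟨ω, Covering.follows_doubledBall hlt,
      le_add_of_nonneg_right (mul_nonneg hsum (Covering.codingDefect_nonneg _ _ _ _))⟩
  · obtain ⟨i⟩ := ‹Nonempty ι›
    obtain ⟨ω₀, hω₀⟩ := (V i).exists_codes τ f n
    refine ⟨⟨i, ω₀⟩, Covering.follows_doubledBall
      (hω₀.codingDefect_eq_zero.trans_lt one_pos), ?_⟩
    calc FamilyWord.cost K (⟨i, ω₀⟩ : FamilyWord V n)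
        ≤ ∑ ω' : FamilyWord V n, ω'.cost K :=
          Finset.single_le_sum (f := FamilyWord.cost K) (fun _ _ => NNReal.coe_nonneg _)
            (Finset.mem_univ (⟨i, ω₀⟩ : FamilyWord V n))
      _ ≤ (∑ ω' : FamilyWord V n, ω'.cost K) * (V ω.1).codingDefect τ ω.2 f :=
          le_mul_of_one_le_right hsum hge
      _ ≤ _ := le_add_of_nonneg_left (NNReal.coe_nonneg _)

theorem exists_overhead_cost_le (hH3 : K.Shannon) (hH4 : K.Counting) (V : ι → S.Covering a b ε)
    (q : ℕ) :
    ∃ c : ℝ, ∀ n : ℕ, overhead q n (FamilyWord.cost K : FamilyWord V n → ℝ) ≤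
      ComplexityFunction.logError c n + n * Real.logb 2 q := by
  choose D hD0 hD using fun i => ComplexityFunction.exists_kraftSum_le hH3 hH4 (V i).card
  have hD' : 0 < ∑ i, D i := Finset.sum_pos (fun i _ => hD0 i) Finset.univ_nonempty
  refine ⟨|Real.logb 2 (∑ i, D i)| + 1, fun n => add_le_add_left ?_ _⟩
  have := nonempty_familyWord V n
  have hkraft : kraftSum (FamilyWord.cost K : FamilyWord V n → ℝ) ≤ (∑ i, D i) * (n + 1) := by
    rw [kraftSum, Fintype.sum_sigma, Finset.sum_mul]
    exact Finset.sum_le_sum fun i _ => hD i n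
  have hlog : 0 ≤ Real.logb 2 ((n : ℝ) + 1) := mod_cast logb_two_natCast_nonneg (n + 1)
  have hpos : 0 < kraftSum (FamilyWord.cost K : FamilyWord V n → ℝ) :=
    Finset.sum_pos (fun _ _ => Real.rpow_pos_of_pos two_pos _) Finset.univ_nonempty
  calc Real.logb 2 (kraftSum (FamilyWord.cost K : FamilyWord V n → ℝ))
      ≤ Real.logb 2 ((∑ i, D i) * (n + 1)) := Real.logb_le_logb_of_le one_lt_two hpos hkraft
    _ = Real.logb 2 (∑ i, D i) + Real.logb 2 (n + 1) :=
        Real.logb_mul hD'.ne' n.cast_add_one_ne_zero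
    _ ≤ ComplexityFunction.logError (|Real.logb 2 (∑ i, D i)| + 1) n := by
        rw [ComplexityFunction.logError]
        nlinarith [le_abs_self (Real.logb 2 (∑ i, D i)), abs_nonneg (Real.logb 2 (∑ i, D i))]

end

end ExtendedSystem

section

variable {X : Type*} [MeasurableSpace X] {μ : Measure X}

theorem ofReal_le_lintegral_limsup [IsFiniteMeasure μ] {F : ℕ → X → ℝ≥0∞} {B : ℝ≥0} {u : ℕ → ℝ}
    {l : ℝ} (hu : Tendsto u atTop (𝓝 l))
    (hF : ∀ᶠ n in atTop, Measurable (F n) ∧ (∀ x, F n x ≤ B) ∧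
      ENNReal.ofReal (u n) ≤ ∫⁻ x, F n x ∂μ) :
    ENNReal.ofReal l ≤ ∫⁻ x, limsup (fun n => F n x) atTop ∂μ := by
  obtain ⟨N, hN⟩ := eventually_atTop.1 hF
  have hN' := fun n => hN (n + N) (Nat.le_add_left N n)
  calc ENNReal.ofReal l = limsup (fun n => ENNReal.ofReal (u (n + N))) atTop :=
        (((ENNReal.continuous_ofReal.tendsto l).comp hu).comp
          (tendsto_add_atTop_nat N)).limsup_eq.symm
    _ ≤ limsup (fun n => ∫⁻ x, F (n + N) x ∂μ) atTop :=
        limsup_le_limsup (Eventually.of_forall fun n => (hN' n).2.2)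
    _ ≤ ∫⁻ x, limsup (fun n => F (n + N) x) atTop ∂μ :=
        limsup_lintegral_le (fun _ => (B : ℝ≥0∞)) (fun n => (hN' n).1)
          (fun n => Eventually.of_forall (hN' n).2.1)
          (by simpa using ENNReal.mul_ne_top ENNReal.coe_ne_top (measure_ne_top μ univ))
    _ = ∫⁻ x, limsup (fun n => F n x) atTop ∂μ :=
        lintegral_congr fun x => limsup_nat_add (fun n => F n x) N

theorem ofReal_div_le_lintegral_div {F : X → ℝ≥0∞} {x l : ℝ} (hl : 0 < l)
    (h : ENNReal.ofReal x ≤ ∫⁻ y, F y ∂μ) :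
    ENNReal.ofReal (x / l) ≤ ∫⁻ y, F y / ENNReal.ofReal l ∂μ := by
  rw [ENNReal.ofReal_div_of_pos hl]
  simp only [div_eq_mul_inv]
  exact (mul_le_mul_left h _).trans (lintegral_mul_const_le _ _)

end

namespace ExtendedSystem

variable {S : ExtendedSystem} {K : ComplexityFunction}

/-! ### Measurability and bounds for the complexity of orbits -/

section

variable {a b ε τ : ℝ}

theorem Covering.measurable_orbitComplexity (hA1 : S.WindowsCompact) (hA3 : S.SeparationBound)
    (hab : a < b) (U : S.Covering a b ε) (K : ComplexityFunction) (τ : ℝ) (n : ℕ) :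
    Measurable fun f => U.orbitComplexity K τ f n := by
  classical
  refine Measurable.iInf fun ω => ?_
  have hcodes : MeasurableSet {f : S.State | U.Codes τ f n ω} := by
    simp only [Covering.Codes, ofPred_forall]
    exact MeasurableSet.iInter fun j =>
      ((isOpen_wdist_lt hab _ _).preimage (hA3.continuous_φ hA1 _)).measurableSet
  simp only [iInf_eq_if]
  exact Measurable.ite hcodes measurable_const measurable_const

theorem Covering.measurable_rate (hA1 : S.WindowsCompact) (hA3 : S.SeparationBound)
    (hab : a < b) (U : S.Covering a b ε) (K : ComplexityFunction) (τ : ℝ) :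
    Measurable (U.rate K τ) :=
  Measurable.limsup fun n => (U.measurable_orbitComplexity hA1 hA3 hab K τ n).div_const _

theorem Covering.exists_orbitComplexity_div_le (hK : K.Shannon) (U : S.Covering a b ε) (τ : ℝ) :
    ∃ B : ℝ≥0, ∀ (f : S.State) (n : ℕ), 0 < n → U.orbitComplexity K τ f n / n ≤ B := by
  obtain ⟨B, hB⟩ := hK.exists_linear_bound U.card
  refine ⟨2 * B, fun f n hn => ?_⟩
  obtain ⟨ω, hω⟩ := U.exists_codes τ f n
  rw [ENNReal.div_le_iff (Nat.cast_ne_zero.2 hn.ne') (ENNReal.natCast_ne_top n)]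
  refine (Covering.orbitComplexity_le_of_codes hω).trans ?_
  have hn' : (1 : ℝ≥0) ≤ n := mod_cast hn
  have hlen : K U.card (List.ofFn ω) ≤ B * (n + 1) := by
    have := hB (List.ofFn ω)
    rw [List.length_ofFn] at this
    exact_mod_cast this
  have hle : K U.card (List.ofFn ω) ≤ 2 * B * n :=
    calc _ ≤ B * (n + 1) := hlen
      _ ≤ B * (n + n) := by gcongr
      _ = 2 * B * n := by ring
  exact_mod_cast hle

theorem Covering.exists_rate_le (hK : K.Shannon) (U : S.Covering a b ε) (τ : ℝ) :
    ∃ B : ℝ≥0, ∀ f : S.State, U.rate K τ f ≤ B := by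
  obtain ⟨B, hB⟩ := U.exists_orbitComplexity_div_le hK τ
  refine ⟨B, fun f => limsup_le_of_le (by isBoundedDefault) ?_⟩
  exact (eventually_gt_atTop 0).mono fun n hn => hB f n hn

end

section

variable {a b a' b' ε ε' τ : ℝ}

/-- The covering obtained by enlarging every ball of a covering, possibly over another window. -/
def Covering.enlarge (U : S.Covering a b ε) (B : Fin U.card → S.Ball ε')
    (hB : ∀ i f, S.wdist a b f (U.center i) < U.radius i → (B i).Mem a' b' f) :
    S.Covering a' b' ε' where
  card := U.card
  center i := (B i).center
  radius i := (B i).radius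
  radius_pos i := (B i).radius_pos
  radius_lt i := (B i).radius_lt
  covers f := (U.covers f).imp fun i => hB i f

theorem Covering.rate_enlarge_le (U : S.Covering a b ε) (B : Fin U.card → S.Ball ε')
    (hB : ∀ i f, S.wdist a b f (U.center i) < U.radius i → (B i).Mem a' b' f) (f : S.State) :
    (U.enlarge B hB).rate K τ f ≤ U.rate K τ f :=
  limsup_le_limsup <| Eventually.of_forall fun n => ENNReal.div_le_div_right
    (le_iInf₂ fun ω hω => Covering.orbitComplexity_le_of_codes (U := U.enlarge B hB) (ω := ω)
      fun j => hB _ _ (hω j)) _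

theorem windowComplexity_mono (ha : a ≤ a') (h : a' < b') (hb : b' ≤ b) (f : S.State) :
    S.windowComplexity K τ ε a' b' f ≤ S.windowComplexity K τ ε a b f :=
  le_iInf fun U => (iInf_le _ _).trans <| U.rate_enlarge_le
    (fun i => ⟨U.center i, U.radius i, U.radius_pos i, U.radius_lt i⟩)
    (fun _ _ hf => (wdist_mono ha h hb _ _).trans_lt hf) f

theorem exists_countable_coverings (hA1 : S.WindowsCompact) (K : ComplexityFunction) (τ : ℝ)
    (hε : 0 < ε) (hεε' : ε < ε') (hab : a < b) :
    ∃ V : ℕ → S.Covering a b ε', ∀ U : S.Covering a b ε, ∃ i, ∀ f,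
      (V i).rate K τ f ≤ U.rate K τ f := by
  obtain ⟨δ, hδ0, hδ⟩ := exists_between (sub_pos.2 hεε')
  obtain ⟨t, ht⟩ := hA1.exists_finset_wdist_lt hδ0 hab
  let B (z : t) : S.Ball ε' := ⟨z, ε + δ, add_pos hε hδ0, by linarith⟩
  let I := {x : Σ r : ℕ, Fin r → t // ∀ f : S.State, ∃ i, (B (x.2 i)).Mem a b f}
  let V (x : I) : S.Covering a b ε' :=
    { card := x.1.1
      center := fun i => (B (x.1.2 i)).center
      radius := fun i => (B (x.1.2 i)).radius
      radius_pos := fun i => (B (x.1.2 i)).radius_pos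
      radius_lt := fun i => (B (x.1.2 i)).radius_lt
      covers := x.2 }
  have hI : Nonempty I := by
    refine ⟨⟨⟨t.card, t.equivFin.symm⟩, fun f => ?_⟩⟩
    obtain ⟨z, hz, hf⟩ := ht f
    refine ⟨t.equivFin ⟨z, hz⟩, ?_⟩
    simpa [B, Ball.Mem] using hf.trans (lt_add_of_pos_left δ hε)
  obtain ⟨e, he⟩ := exists_surjective_nat I
  refine ⟨fun i => V (e i), fun U => ?_⟩
  choose σ hσt hσ using fun i => ht (U.center i)
  have hB : ∀ i f, S.wdist a b f (U.center i) < U.radius i → (B ⟨σ i, hσt i⟩).Mem a b f :=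
    fun i f hf => (wdist_triangle hab f (U.center i) (σ i)).trans_lt
      (add_lt_add (hf.trans (U.radius_lt i)) (hσ i))
  obtain ⟨i, hi⟩ := he ⟨⟨U.card, fun i => ⟨σ i, hσt i⟩⟩, (U.enlarge _ hB).covers⟩
  exact ⟨i, fun f =>
    (congrArg (fun x => (V x).rate K τ f) hi).trans_le (U.rate_enlarge_le _ hB f)⟩

end

/-! ### Lower bound for the complexity of orbits under a cost bound -/

section

variable {q : ℕ} {μ : Measure S.State} {τ ε h : ℝ}

section

variable {a : ℝ} {L : ℕ} {ι : Type} [Nonempty ι]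

theorem CostBound.le_lintegral_iInf_orbitComplexity [Fintype ι] [IsFiniteMeasure μ]
    (hμ : S.CostBound q μ τ ε h) (hA1 : S.WindowsCompact) (hA3 : S.SeparationBound) (hL : 0 < L)
    {n : ℕ} (hn : 0 < n) (V : ι → S.Covering a (a + L) (ε / 2)) :
    ENNReal.ofReal (h * L * n - overhead q n (FamilyWord.cost K : FamilyWord V n → ℝ)) ≤
      ∫⁻ f, ⨅ i, (V i).orbitComplexity K τ f n ∂μ := by
  have := hA1.compactSpace
  have hcont : Continuous (smoothCost K τ V n) :=
    continuous_smoothCost hA1 hA3 (lt_add_of_pos_right a (Nat.cast_pos.2 hL)) V n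
  obtain ⟨C, hC⟩ := bddFun_of_continuous hcont
  calc _ ≤ ENNReal.ofReal (∫ f, smoothCost K τ V n f ∂μ) := ENNReal.ofReal_le_ofReal <|
        hμ a L n _ _ _ _ hL hn hcont (codesWithin_smoothCost K τ V n)
    _ = ∫⁻ f, ENNReal.ofReal (smoothCost K τ V n f) ∂μ :=
        ofReal_integral_eq_lintegral_ofReal
          (.of_bound hcont.measurable.aestronglyMeasurable C (Eventually.of_forall hC))
          (Eventually.of_forall (smoothCost_nonneg V))
    _ ≤ _ := lintegral_mono (ofReal_smoothCost_le V)

theorem CostBound.le_lintegral_iInf_rate [Finite ι] [IsFiniteMeasure μ]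
    (hμ : S.CostBound q μ τ ε h) (hA1 : S.WindowsCompact) (hA3 : S.SeparationBound)
    (hH3 : K.Shannon) (hH4 : K.Counting) (hL : 0 < L) (V : ι → S.Covering a (a + L) (ε / 2)) :
    ENNReal.ofReal (h * L - Real.logb 2 q) ≤ ∫⁻ f, ⨅ i, (V i).rate K τ f ∂μ := by
  have := Fintype.ofFinite ι
  obtain ⟨c, hc⟩ := exists_overhead_cost_le hH3 hH4 V q
  obtain ⟨i₀⟩ := ‹Nonempty ι›
  obtain ⟨B, hB⟩ := (V i₀).exists_orbitComplexity_div_le hH3 τ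
  have hlim : Tendsto (fun n : ℕ => h * L - ComplexityFunction.logError c n / n - Real.logb 2 q)
      atTop (𝓝 (h * L - Real.logb 2 q)) := by
    simpa using ((ComplexityFunction.tendsto_logError_div c).const_sub (h * L)).sub_const
      (Real.logb 2 q)
  have hfatou := ofReal_le_lintegral_limsup (μ := μ) (B := B)
    (F := fun (n : ℕ) f => (⨅ i, (V i).orbitComplexity K τ f n) / n) hlim <| by
    filter_upwards [eventually_gt_atTop 0] with n hn
    have hn' : (0 : ℝ) < n := Nat.cast_pos.2 hn
    refine ⟨(Measurable.iInf fun i => (V i).measurable_orbitComplexity hA1 hA3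
      (lt_add_of_pos_right a (Nat.cast_pos.2 hL)) K τ n).div_const _,
      fun f => (ENNReal.div_le_div_right (iInf_le _ i₀) _).trans (hB f n hn), ?_⟩
    have hcost := ofReal_div_le_lintegral_div hn'
      (hμ.le_lintegral_iInf_orbitComplexity (K := K) hA1 hA3 hL hn V)
    rw [ENNReal.ofReal_natCast] at hcost
    refine (ENNReal.ofReal_le_ofReal ?_).trans hcost
    rw [le_div_iff₀ hn', sub_mul, sub_mul, div_mul_cancel₀ _ hn'.ne']
    linarith [hc n]
  exact hfatou.trans <| lintegral_mono fun f => le_iInf fun i =>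
    limsup_le_limsup (Eventually.of_forall fun n => ENNReal.div_le_div_right (iInf_le _ i) _)

end

theorem CostBound.le_lintegral_iInf_rate_nat [IsFiniteMeasure μ] (hμ : S.CostBound q μ τ ε h)
    (hA1 : S.WindowsCompact) (hA3 : S.SeparationBound) (hH3 : K.Shannon) (hH4 : K.Counting)
    {a : ℝ} {L : ℕ} (hL : 0 < L) (V : ℕ → S.Covering a (a + L) (ε / 2)) :
    ENNReal.ofReal (h * L - Real.logb 2 q) ≤ ∫⁻ f, ⨅ i, (V i).rate K τ f ∂μ := by
  let R (p : ℕ) (f : S.State) : ℝ≥0∞ := ⨅ i : Fin (p + 1), (V i).rate K τ f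
  have hR : ∀ f, ⨅ i, (V i).rate K τ f = ⨅ p, R p f := fun f =>
    le_antisymm (le_iInf₂ fun p i => iInf_le _ _) <| le_iInf fun i =>
      (iInf_le _ i).trans (iInf_le (fun k : Fin (i + 1) => (V k).rate K τ f) (Fin.last i))
  have hmeas : ∀ p, Measurable (R p) := fun p => Measurable.iInf fun i =>
    (V i).measurable_rate hA1 hA3 (lt_add_of_pos_right a (Nat.cast_pos.2 hL)) K τ
  have hanti : Antitone R := fun p p' hpp' f => le_iInf fun i =>
    iInf_le (fun k : Fin (p' + 1) => (V k).rate K τ f) (i.castLE (Nat.succ_le_succ hpp'))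
  have hfin : ∫⁻ f, R 0 f ∂μ ≠ ⊤ := by
    obtain ⟨B, hB⟩ := (V 0).exists_rate_le hH3 τ
    refine ne_top_of_le_ne_top (b := ∫⁻ _, (B : ℝ≥0∞) ∂μ) ?_
      (lintegral_mono fun f => (iInf_le _ 0).trans (hB f))
    simpa using ENNReal.mul_ne_top ENNReal.coe_ne_top (measure_ne_top μ univ)
  simp only [hR]
  rw [lintegral_iInf hmeas hanti hfin]
  exact le_iInf fun p => hμ.le_lintegral_iInf_rate hA1 hA3 hH3 hH4 hL fun i : Fin (p + 1) => V i

theorem CostBound.exists_measurable_le_windowComplexity [IsFiniteMeasure μ]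
    (hμ : S.CostBound q μ τ ε h) (hA1 : S.WindowsCompact) (hA3 : S.SeparationBound)
    (hH3 : K.Shannon) (hH4 : K.Counting) (hε : 0 < ε) (hh : 0 ≤ h) {a b : ℝ} (hab : 1 ≤ b - a) :
    ∃ F : S.State → ℝ≥0∞, Measurable F ∧ (∀ f, F f ≤ S.windowComplexity K τ (ε / 4) a b f) ∧
      ENNReal.ofReal (h * (b - a - 1) - Real.logb 2 q) ≤ ∫⁻ f, F f ∂μ := by
  have hL : 0 < ⌊b - a⌋₊ := Nat.floor_pos.2 hab
  have haL : a < a + ⌊b - a⌋₊ := lt_add_of_pos_right a (Nat.cast_pos.2 hL)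
  have hLb : a + ⌊b - a⌋₊ ≤ b := by linarith [Nat.floor_le (zero_le_one.trans hab)]
  obtain ⟨V, hV⟩ := exists_countable_coverings hA1 K τ (by linarith : 0 < ε / 4)
    (by linarith : ε / 4 < ε / 2) haL
  refine ⟨fun f => ⨅ i, (V i).rate K τ f,
    Measurable.iInf fun i => (V i).measurable_rate hA1 hA3 haL K τ, fun f => ?_, ?_⟩
  · refine le_trans (le_iInf fun U => ?_) (windowComplexity_mono le_rfl haL hLb f)
    obtain ⟨i, hi⟩ := hV U
    exact (iInf_le _ i).trans (hi f)
  · refine (ENNReal.ofReal_le_ofReal ?_).trans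
      (hμ.le_lintegral_iInf_rate_nat hA1 hA3 hH3 hH4 hL V)
    gcongr
    linarith [Nat.lt_floor_add_one (b - a)]

theorem CostBound.le_lintegral_pointComplexity [IsFiniteMeasure μ] (hμ : S.CostBound q μ τ ε h)
    (hA1 : S.WindowsCompact) (hA2 : S.BallsGlue) (hA3 : S.SeparationBound)
    (hH3 : K.Shannon) (hH4 : K.Counting) (hε : 0 < ε) (hh : 0 ≤ h) {a b : ℕ → ℝ}
    (hab : Tendsto (fun k => b k - a k) atTop atTop) :
    ENNReal.ofReal h ≤ ∫⁻ f, S.pointComplexity K τ (ε / 4) a b f ∂μ := by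
  choose! F hFmeas hFle hF using fun k (hk : 1 ≤ b k - a k) =>
    hμ.exists_measurable_le_windowComplexity hA1 hA3 hH3 hH4 hε hh hk
  obtain ⟨B, hB⟩ := exists_windowComplexity_le hA1 hA2 hH3 τ (by linarith : 0 < ε / 4)
  have hlarge := hab.eventually_ge_atTop 1
  have hlim : Tendsto (fun k => (h * (b k - a k - 1) - Real.logb 2 q) / (b k - a k)) atTop
      (𝓝 h) := by
    have herror : Tendsto (fun k => h - (h + Real.logb 2 q) / (b k - a k)) atTop (𝓝 h) := by
      simpa using (hab.const_div_atTop (h + Real.logb 2 q)).const_sub h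
    refine herror.congr' (hlarge.mono fun k hk => ?_)
    have : b k - a k ≠ 0 := (one_pos.trans_le hk).ne'
    field_simp
    ring
  have hfatou := ofReal_le_lintegral_limsup (μ := μ) (B := B * 2)
    (F := fun k f => F k f / ENNReal.ofReal (b k - a k)) hlim <| hlarge.mono fun k hk => by
    have hpos : 0 < b k - a k := one_pos.trans_le hk
    refine ⟨(hFmeas k hk).div_const _, fun f => ?_, ofReal_div_le_lintegral_div hpos (hF k hk)⟩
    rw [ENNReal.div_le_iff (ENNReal.ofReal_pos.2 hpos).ne' ENNReal.ofReal_ne_top]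
    calc F k f ≤ B * ENNReal.ofReal (b k - a k + 1) :=
          (hFle k hk f).trans (hB _ _ (sub_pos.1 hpos) f)
      _ ≤ B * ENNReal.ofReal (2 * (b k - a k)) := by gcongr; linarith
      _ = (B * 2 : ℝ≥0) * ENNReal.ofReal (b k - a k) := by
          rw [ENNReal.ofReal_mul two_pos.le]
          push_cast
          simp [mul_assoc]
  exact hfatou.trans <| lintegral_mono fun f => limsup_le_limsup <|
    hlarge.mono fun k hk => ENNReal.div_le_div_right (hFle k hk f) _

end

/-! ### The variational principle -/

theorem upperTopEntropy_le_iSup_measureComplexity (hA1 : S.WindowsCompact) (hA2 : S.BallsGlue)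
    (hA3 : S.SeparationBound) (hH3 : K.Shannon) (hH4 : K.Counting) {τ : ℝ} (hτ : 0 < τ)
    {a b : ℕ → ℝ} (hab : Tendsto (fun k => b k - a k) atTop atTop) :
    S.upperTopEntropy ≤
      ⨆ (μ : Measure S.State) (_ : IsProbabilityMeasure μ) (_ : S.IsInvariant μ),
        S.measureComplexity K τ a b μ := by
  refine le_of_forall_lt fun x hx => ?_
  obtain ⟨c, hxc, hcx⟩ := ENNReal.lt_iff_exists_nnreal_btwn.1 hx
  have hc0 : (0 : ℝ) < c := NNReal.coe_pos.2 (ENNReal.coe_pos.1 (bot_le.trans_lt hxc))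
  refine hxc.trans_le ?_
  rw [← ENNReal.ofReal_coe_nnreal] at hcx ⊢
  obtain ⟨q, hq⟩ := hA2.exists_gluesWith
  obtain ⟨ε, μ, hε, hprob, hinv, hcost⟩ :=
    exists_invariant_measure_costBound hA1 hA3 hq hτ hc0 hcx
  refine le_iSup_of_le μ (le_iSup₂_of_le hprob hinv ?_)
  rw [measureComplexity, ENNReal.le_div_iff_mul_le (Or.inl (by simpa using hτ))
    (Or.inl ENNReal.ofReal_ne_top), ← ENNReal.ofReal_mul hc0.le]
  exact (hcost.le_lintegral_pointComplexity hA1 hA2 hA3 hH3 hH4 hε (by positivity) hab).trans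
    (le_iSup₂_of_le (ε / 4) (by linarith) le_rfl)

theorem neBot_windowsToInfinity : windowsToInfinity.NeBot := by
  refine comap_neBot fun s hs => ?_
  obtain ⟨x, hx⟩ := Filter.nonempty_of_mem hs
  exact ⟨(0, x), by simpa using hx⟩

theorem lowerTopEntropy_le_upperTopEntropy : S.lowerTopEntropy ≤ S.upperTopEntropy :=
  have := neBot_windowsToInfinity
  iSup₂_mono fun _ _ => (liminf_le_limsup (by isBoundedDefault) (by isBoundedDefault)).trans <|
    limsup_le_limsup <| Eventually.of_forall fun _ => ENNReal.div_le_div_right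
      (liminf_le_limsup (by isBoundedDefault) (by isBoundedDefault)) _

end ExtendedSystem

end

theorem theorem2_general (S : ExtendedSystem)
    (hA1 : S.WindowsCompact) (hA2 : S.BallsGlue) (hA3 : S.SeparationBound)
    (K : ComplexityFunction) (hH3 : K.Shannon) (hH4 : K.Counting) (τ : ℝ) (hτ : 0 < τ)
    (a b : ℕ → ℝ) (hab : Tendsto (fun k => b k - a k) atTop atTop) :
    (⨆ (μ : Measure S.State) (_ : IsProbabilityMeasure μ) (_ : S.IsInvariant μ),
        S.measureComplexity K τ a b μ) = S.upperTopEntropy ∧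
    (⨆ (μ : Measure S.State) (_ : IsProbabilityMeasure μ) (_ : S.IsInvariant μ),
        S.measureComplexity K τ a b μ) = S.lowerTopEntropy := by
  have hle : (⨆ (μ : Measure S.State) (_ : IsProbabilityMeasure μ) (_ : S.IsInvariant μ),
      S.measureComplexity K τ a b μ) ≤ S.lowerTopEntropy :=
    iSup_le fun μ => iSup₂_le fun _ _ =>
      ExtendedSystem.measureComplexity_le_lowerTopEntropy hA2 hH3 hτ hab μ
  have hlower := S.lowerTopEntropy_le_upperTopEntropy
  have hge := ExtendedSystem.upperTopEntropy_le_iSup_measureComplexity hA1 hA2 hA3 hH3 hH4 hτ hab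
  exact ⟨(hle.trans hlower).antisymm hge, hle.antisymm (hlower.trans hge)⟩

theorem theorem2 (S : ExtendedSystem)
    (hA1 : S.WindowsCompact) (hA2 : S.BallsGlue) (hA3 : S.SeparationBound)
    (K : ComplexityFunction)
    (hH1 : K.Concat) (hH2 : K.Projection) (hH3 : K.Shannon) (hH4 : K.Counting)
    (τ : ℝ) (hτ : 0 < τ) (a b : ℕ → ℝ) (hab : AdmissibleWindows a b) :
    (⨆ (μ : Measure S.State) (_ : IsProbabilityMeasure μ) (_ : S.IsInvariant μ),
        S.measureComplexity K τ a b μ) = S.upperTopEntropy ∧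
    (⨆ (μ : Measure S.State) (_ : IsProbabilityMeasure μ) (_ : S.IsInvariant μ),
        S.measureComplexity K τ a b μ) = S.lowerTopEntropy :=
  theorem2_general S hA1 hA2 hA3 K hH3 hH4 τ hτ a b hab.length
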